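/- **Setting.** Let $r>0$. A function $g:[a,b]\to\mathbb{R}^d$ is in $\mathcal{PC}([a,b],\mathbb{R}^d)$ if it is right-continuous on $[a,b)$, has a left limit $g(t^-)$ at every $t\in(a,b]$, and $g(t^-)\neq g(t)$ for at most finitely many $t$; $g\in\mathcal{PC}([a,\infty),\mathbb{R}^d)$ if $g|_{[a,b]}\in\mathcal{PC}([a,b],\mathbb{R}^d)$ for all $b>a$. Write $\mathcal{PC}=\mathcal{PC}([-r,0],\mathbb{R}^n)$, $\|\varphi\|_r=\sup_{s\in[-r,0]}\|\varphi(s)\|$, $x_t(s)=x(t+s)$ for $s\in[-r,0]$, and let $x_{t^-}$ be $x_t$ with its value at $s=0$ replaced by $x(t^-)$. Consider $$\dot x(t)=f(t,x_t,w(t))\ (t\ge t_0,\ t\neq t_k),\qquad x(t_k)-x(t_k^-)=I_k(t_k,x_{t_k^-},w(t_k^-))\ (k\ge1),\qquad x_{t_0}=\varphi,$$ where $0\le t_0<t_1<t_2<\cdots\to\infty$, $\varphi\in\mathcal{PC}$, $w\in\mathcal{PC}([t_0,\infty),\mathbb{R}^m)$, and $f,I_k:\mathbb{R}^+\times\mathcal{PC}\times\mathbb{R}^m\to\mathbb{R}^n$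 satisfy $f(t,0,0)=I_k(t,0,0)=0$. Solutions are piecewise right-continuous, continuous away from the $t_k$, and $\dot x$ is the right-hand derivative. It is assumed that for all $t_0\ge0$ and $w\in\mathcal{PC}([t_0,\infty),\mathbb{R}^m)$ the functional $g(t,\phi)=f(t,\phi,w(t))$ is, on $[t_0,\infty)$: composite-PC ($t\mapsto g(t,x_t)$ is in $\mathcal{PC}([t_0,b],\mathbb{R}^n)$ whenever $x\in\mathcal{PC}([t_0-r,b],\mathbb{R}^n)$), quasi-bounded (bounded on $\{(t,\phi):t\in[t_0,b],\|\phi\|_r\le R\}$ for all $b,R$), and locally Lipschitz (Lipschitz in $\phi$ with respect to $\|\cdot\|_r$ on each such set, uniformly in $t$). Class $\mathcal{K}$: continuous strictly increasing $\alpha:\mathbb{R}^+\to\mathbb{R}$ with $\alpha(0)=0$; $\mathcal{K}_\infty$: unbounded members of $\mathcal{K}$; $\mathcal{KL}$: continuous $\beta:\mathbb{R}^+\times\mathbb{R}^+\to\mathbb{R}^+$ with $\beta(\cdot,t)\in\mathcal{K}$ for each $t$ and $\beta(s,t)$ decreasing to $0$ as $t\to\infty$ for each $s$. For $\delta>0$,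 $\ell_{\sup}(\delta)$ is the class of sequences $(t_k)_{k\ge0}$ as above with $t_k-t_{k-1}\le\delta$ for all $k\ge1$. The system is *uniformly iISS* over a class $\ell$ if there are $\beta\in\mathcal{KL}$ and $\alpha,\gamma\in\mathcal{K}_\infty$ such that for every sequence in $\ell$, every $\varphi\in\mathcal{PC}$ and every $w\in\mathcal{PC}([t_0,\infty),\mathbb{R}^m)$ the system has a unique solution, it exists globally, and for all $t\ge t_0$ $$\alpha(\|x(t)\|)\le\beta(\|\varphi\|_r,t-t_0)+\int_{t_0}^t\gamma(\|w(s)\|)\,ds+\sum_{t_0<t_k\le t}\gamma(\|w(t_k^-)\|).$$ Let $V_1:[-r,\infty)\times\mathbb{R}^n\to\mathbb{R}^+$ be of class $\nu_0$: for each $x\in\mathcal{PC}([0,\infty),\mathbb{R}^n)$ the function $t\mapsto V_1(t,x(t))$ is in $\mathcal{PC}([0,\infty),\mathbb{R})$ and is continuous wherever $x$ is. Let $V_2:\mathbb{R}^+\times\mathcal{PC}\to\mathbb{R}^+$ be of class $\nu_0^*$: for each $x\in\mathcal{PC}([-r,\infty),\mathbb{R}^n)$ the function $t\mapsto V_2(t,x_t)$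 is continuous on $[0,\infty)$. Put $V(t,\phi)=V_1(t,\phi(0))+V_2(t,\phi)$ and $$\mathrm{D}^+V(t,\phi)=\limsup_{h\to0^+}\tfrac1h\big[V(t+h,x_{t+h})-V(t,\phi)\big],$$ where $x$ solves $\dot x=f(\cdot,x_{\cdot},w(\cdot))$ (without impulses) to the right of $t$ with $x_t=\phi$. **Theorem.** Assume there are $\alpha_1,\alpha_2,\alpha_3,\chi\in\mathcal{K}_\infty$ and constants $\mu>0$, $\kappa>0$, $0\le\rho_1<1$, $\rho_2\ge0$ such that for all $t\ge0$, $\phi\in\mathcal{PC}$, $y\in\mathbb{R}^m$, $k\ge1$ and all inputs $w$: (i) $\alpha_1(\|x\|)\le V_1(s,x)\le\alpha_2(\|x\|)$ for all $s\ge-r$, $x\in\mathbb{R}^n$, and $0\le V_2(t,\phi)\le\alpha_3(\|\phi\|_r)$; (ii) $\mathrm{D}^+V(t,\phi)\le(\chi(\|w(t)\|)+\mu)V(t,\phi)+\chi(\|w(t)\|)$; (iii) $V_1(t,\phi(0)+I_k(t,\phi,y))\le\rho_1V_1(t,\phi(0))+\rho_2\sup_{s\in[-r,0]}V_1(t+s,\phi(s))+\chi(\|y\|)$;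 (iv) $V_2(t,\phi)\le\kappa\sup_{s\in[-r,0]}V_1(t+s,\phi(s))$; (v) $\ln[\rho_1+\rho_2+(1-\rho_1)\kappa]<-\mu\delta$. Then the system is uniformly iISS over $\ell_{\sup}(\delta)$. -/

import Mathlib

open Set Filter Topology

noncomputable section

/-! ### Comparison functions (only their values on `[0, ∞)` matter) -/

/-- Class `K`: continuous and strictly increasing on `[0, ∞)`, zero at zero. -/
structure ClassK (α : ℝ → ℝ) : Prop where
  continuousOn : ContinuousOn α (Ici 0)
  strictMonoOn : StrictMonoOn α (Ici 0)
  map_zero : α 0 = 0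

/-- Class `K_∞`: class `K` and unbounded. -/
structure ClassKInf (α : ℝ → ℝ) : Prop extends ClassK α where
  tendsto_atTop : Tendsto α atTop atTop

/-- Class `KL`. -/
structure ClassKL (β : ℝ → ℝ → ℝ) : Prop where
  continuousOn : ContinuousOn (fun p : ℝ × ℝ => β p.1 p.2) (Ici 0 ×ˢ Ici 0)
  classK : ∀ t, 0 ≤ t → ClassK (fun s => β s t)
  antitoneOn : ∀ s, 0 ≤ s → AntitoneOn (β s) (Ici 0)
  tendsto_zero : ∀ s, 0 ≤ s → Tendsto (β s) atTop (𝓝 0)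

/-! ### Piecewise right-continuous functions -/

section PC

variable {E : Type*} [NormedAddCommGroup E]

/-- `g` restricted to `[a, b]` is piecewise right-continuous: right-continuous on `[a, b)`, with a
left limit at every point of `(a, b]`, which differs from the value at finitely many points only.
All three conditions depend only on the values of `g` on `[a, b]`. -/
structure IsPCOn (g : ℝ → E) (a b : ℝ) : Prop where
  right_cont : ∀ t ∈ Ico a b, Tendsto g (𝓝[>] t) (𝓝 (g t))
  left_lim : ∀ t ∈ Ioc a b, ∃ l, Tendsto g (𝓝[<] t) (𝓝 l)
  finite_disc : {t ∈ Ioc a b | ¬ Tendsto g (𝓝[<] t) (𝓝 (g t))}.Finite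

/-- `g` restricted to `[a, ∞)` belongs to `PC([a, ∞), E)`. -/
def IsPCFrom (g : ℝ → E) (a : ℝ) : Prop := ∀ b, a < b → IsPCOn g a b

variable (E) in
/-- The space `PC([-r, 0], E)`. A function on `[-r, 0]` is stored as a function on `ℝ` that
vanishes off `[-r, 0]`. -/
@[ext] structure PCHist (r : ℝ) where
  toFun : ℝ → E
  isPC : IsPCOn toFun (-r) 0
  eq_zero : ∀ s, s ∉ Icc (-r) 0 → toFun s = 0

instance (r : ℝ) : CoeFun (PCHist E r) (fun _ => ℝ → E) := ⟨PCHist.toFun⟩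

instance (r : ℝ) : Zero (PCHist E r) :=
  ⟨⟨fun _ => 0,
    ⟨fun _ _ => tendsto_const_nhds, fun _ _ => ⟨0, tendsto_const_nhds⟩, by
      simp⟩,
    fun _ _ => rfl⟩⟩

/-- `sup_{s ∈ [-r, 0]} ‖g s‖`. -/
def supNorm (r : ℝ) (g : ℝ → E) : ℝ := ⨆ s : Icc (-r) (0 : ℝ), ‖g s‖

theorem IsPCOn.history {x : ℝ → E} {r t : ℝ} (h : IsPCOn x (t - r) t) :
    IsPCOn ((Icc (-r) (0 : ℝ)).indicator fun s => x (t + s)) (-r) 0 := by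
  have hR : ∀ s : ℝ, Tendsto (fun u => t + u) (𝓝[>] s) (𝓝[>] (t + s)) := fun s =>
    tendsto_nhdsWithin_iff.2 ⟨((continuous_const.add continuous_id).tendsto s).mono_left
      nhdsWithin_le_nhds, by filter_upwards [self_mem_nhdsWithin] with u hu; simpa using hu⟩
  have hL : ∀ s : ℝ, Tendsto (fun u => t + u) (𝓝[<] s) (𝓝[<] (t + s)) := fun s =>
    tendsto_nhdsWithin_iff.2 ⟨((continuous_const.add continuous_id).tendsto s).mono_left
      nhdsWithin_le_nhds, by filter_upwards [self_mem_nhdsWithin] with u hu; simpa using hu⟩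
  have eR : ∀ s ∈ Ico (-r) (0 : ℝ), (fun u => x (t + u)) =ᶠ[𝓝[>] s]
      (Icc (-r) (0 : ℝ)).indicator fun u => x (t + u) := fun s hs => by
    filter_upwards [Ioo_mem_nhdsGT hs.2] with u hu
    have hu' : u ∈ Icc (-r) (0 : ℝ) := ⟨hs.1.trans hu.1.le, hu.2.le⟩
    rw [indicator_of_mem hu']
  have eL : ∀ s ∈ Ioc (-r) (0 : ℝ), (fun u => x (t + u)) =ᶠ[𝓝[<] s]
      (Icc (-r) (0 : ℝ)).indicator fun u => x (t + u) := fun s hs => by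
    filter_upwards [Ioo_mem_nhdsLT hs.1] with u hu
    have hu' : u ∈ Icc (-r) (0 : ℝ) := ⟨hu.1.le, hu.2.le.trans hs.2⟩
    rw [indicator_of_mem hu']
  refine ⟨fun s hs => ?_, fun s hs => ?_, ?_⟩
  · rw [indicator_of_mem (Ico_subset_Icc_self hs)]
    refine Tendsto.congr' (eR s hs) ?_
    exact (h.right_cont (t + s) ⟨by linarith [hs.1], by linarith [hs.2]⟩).comp (hR s)
  · obtain ⟨l, hl⟩ := h.left_lim (t + s) ⟨by linarith [hs.1], by linarith [hs.2]⟩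
    exact ⟨l, (hl.comp (hL s)).congr' (eL s hs)⟩
  · refine (h.finite_disc.preimage ((add_right_injective t).injOn)).subset ?_
    rintro s ⟨hs, hns⟩
    refine ⟨⟨by simp only; linarith [hs.1], by simp only; linarith [hs.2]⟩, fun hc => hns ?_⟩
    rw [indicator_of_mem (Ioc_subset_Icc_self hs)]
    exact (hc.comp (hL s)).congr' (eL s hs)

open Classical in
/-- The history `x_t ∈ PC([-r, 0], E)`, `x_t(s) = x(t + s)`, of a function `x` that is piecewise
right-continuous on `[t - r, t]` (and the dummy value `0` for other functions `x`). -/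
def history (r : ℝ) (x : ℝ → E) (t : ℝ) : PCHist E r :=
  if h : IsPCOn x (t - r) t then
    ⟨(Icc (-r) (0 : ℝ)).indicator fun s => x (t + s), h.history,
      fun _ hs => indicator_of_notMem hs _⟩
  else 0

/-- The history `x_{t⁻}`: `x_{t⁻}(s) = x(t + s)` for `s ∈ [-r, 0)` and `x_{t⁻}(0) = x(t⁻)`. -/
def historyLeft (r : ℝ) (x : ℝ → E) (t : ℝ) : PCHist E r :=
  history r (Function.update x t (Function.leftLim x t)) t

/-! ### Lyapunov functions and functionals -/

/-- Class `ν₀`: for `x ∈ PC([0, ∞), E)`, the function `t ↦ v(t, x(t))` is in `PC([0, ∞), ℝ)` and is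
continuous wherever `x` is. -/
def ClassNu (v : ℝ → E → ℝ) : Prop :=
  ∀ x : ℝ → E, IsPCFrom x 0 →
    IsPCFrom (fun t => v t (x t)) 0 ∧
    ∀ t, 0 ≤ t → ContinuousWithinAt x (Ici 0) t →
      ContinuousWithinAt (fun t => v t (x t)) (Ici 0) t

/-- Class `ν₀*`: for `x ∈ PC([-r, ∞), E)`, the function `t ↦ v(t, x_t)` is continuous on
`[0, ∞)`. -/
def ClassNuStar (r : ℝ) (v : ℝ → PCHist E r → ℝ) : Prop :=
  ∀ x : ℝ → E, IsPCFrom x (-r) → ContinuousOn (fun t => v t (history r x t)) (Ici 0)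

/-- `limsup_{h → 0⁺} (V(t + h, x_{t+h}) - V(t, x_t)) / h`, as an extended real number. -/
def upperDini (r : ℝ) (V : ℝ → PCHist E r → ℝ) (x : ℝ → E) (t : ℝ) : EReal :=
  limsup (fun h : ℝ =>
    (((V (t + h) (history r x (t + h)) - V t (history r x t)) / h : ℝ) : EReal)) (𝓝[>] 0)

end PC

/-! ### The impulsive system -/

section System

variable {E F : Type*} [NormedAddCommGroup E] [NormedSpace ℝ E] [NormedAddCommGroup F]

/-- The standard conditions for existence, uniqueness and continuation of solutions: for every
initial time `t₀ ≥ 0` and every input `w ∈ PC([t₀, ∞), F)`, the functional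
`g(t, φ) = f(t, φ, w(t))`, `t ≥ t₀`, is composite-PC, quasi-bounded and locally Lipschitz. -/
structure RegularRHS (r : ℝ) (f : ℝ → PCHist E r → F → E) : Prop where
  compositePC : ∀ (t₀ : ℝ) (w : ℝ → F), 0 ≤ t₀ → IsPCFrom w t₀ →
    ∀ (b : ℝ) (x : ℝ → E), t₀ < b → IsPCOn x (t₀ - r) b →
      IsPCOn (fun t => f t (history r x t) (w t)) t₀ b
  quasiBounded : ∀ (t₀ : ℝ) (w : ℝ → F), 0 ≤ t₀ → IsPCFrom w t₀ →
    ∀ b R : ℝ, ∃ M : ℝ, ∀ t ∈ Icc t₀ b, ∀ φ : PCHist E r,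
      supNorm r φ ≤ R → ‖f t φ (w t)‖ ≤ M
  locallyLipschitz : ∀ (t₀ : ℝ) (w : ℝ → F), 0 ≤ t₀ → IsPCFrom w t₀ →
    ∀ b R : ℝ, ∃ L : ℝ, ∀ t ∈ Icc t₀ b, ∀ φ ψ : PCHist E r,
      supNorm r φ ≤ R → supNorm r ψ ≤ R →
        ‖f t φ (w t) - f t ψ (w t)‖ ≤ L * supNorm r (fun s => φ s - ψ s)

/-- `x` solves the impulse-free equation `x'(t) = f(t, x_t, w(t))` on `[t₀, T)` with
`x_{t₀} = φ`; the derivative is the right-hand one, since the right-hand side may jump. -/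
structure IsFlow (r : ℝ) (f : ℝ → PCHist E r → F → E) (w : ℝ → F) (t₀ : ℝ) (φ : PCHist E r)
    (T : ℝ) (x : ℝ → E) : Prop where
  init : ∀ s ∈ Icc (-r) 0, x (t₀ + s) = φ s
  cont : ContinuousOn x (Ico t₀ T)
  deriv : ∀ t ∈ Ico t₀ T, HasDerivWithinAt x (f t (history r x t) (w t)) (Ici t) t

/-- `x` solves the impulsive system on `[t₀ - r, T)`, `T ≤ ∞`, with initial time `t₀ = τ 0`,
impulse times `τ 1 < τ 2 < ⋯`, initial function `φ` and input `w`. The derivative is the right-hand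
one, since `t ↦ f(t, x_t, w(t))` may jump also between impulses. -/
structure IsSolution (r : ℝ) (f : ℝ → PCHist E r → F → E) (I : ℕ → ℝ → PCHist E r → F → E)
    (τ : ℕ → ℝ) (φ : PCHist E r) (w : ℝ → F) (T : EReal) (x : ℝ → E) : Prop where
  init : ∀ s ∈ Icc (-r) 0, x (τ 0 + s) = φ s
  isPC : ∀ b : ℝ, τ 0 < b → (b : EReal) < T → IsPCOn x (τ 0 - r) b
  cont : ∀ t : ℝ, τ 0 < t → (t : EReal) < T → (∀ k, 1 ≤ k → t ≠ τ k) → ContinuousAt x t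
  deriv : ∀ t : ℝ, τ 0 ≤ t → (t : EReal) < T →
    HasDerivWithinAt x (f t (history r x t) (w t)) (Ici t) t
  jump : ∀ k, 1 ≤ k → (τ k : EReal) < T →
    x (τ k) - Function.leftLim x (τ k) =
      I k (τ k) (historyLeft r x (τ k)) (Function.leftLim w (τ k))

/-- `ℓ_sup(δ)`: sequences `0 ≤ t₀ < t₁ < t₂ < ⋯ → ∞` (initial time first, then the impulse times)
with `t_k - t_{k-1} ≤ δ` for all `k ≥ 1`. -/
def ellSup (δ : ℝ) : Set (ℕ → ℝ) :=
  {τ | 0 ≤ τ 0 ∧ StrictMono τ ∧ Tendsto τ atTop atTop ∧ ∀ k, τ (k + 1) - τ k ≤ δ}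

/-- Uniform integral input-to-state stability over a class `ℓ` of sequences: there are `β ∈ KL` and
`α, γ ∈ K_∞` such that, for each sequence in `ℓ`, each initial function and each input, there is
a global solution, every solution is a restriction of it, and it satisfies the iISS estimate. -/
def UniformlyIISS (r : ℝ) (f : ℝ → PCHist E r → F → E) (I : ℕ → ℝ → PCHist E r → F → E)
    (ℓ : Set (ℕ → ℝ)) : Prop :=
  ∃ (β : ℝ → ℝ → ℝ) (α γ : ℝ → ℝ), ClassKL β ∧ ClassKInf α ∧ ClassKInf γ ∧
    ∀ τ ∈ ℓ, ∀ (φ : PCHist E r) (w : ℝ → F), IsPCFrom w (τ 0) →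
      ∃ x : ℝ → E, IsSolution r f I τ φ w ⊤ x ∧
        (∀ (T : EReal) (y : ℝ → E), IsSolution r f I τ φ w T y →
          ∀ t : ℝ, τ 0 - r ≤ t → (t : EReal) < T → y t = x t) ∧
        ∀ t, τ 0 ≤ t →
          α ‖x t‖ ≤ β (supNorm r φ) (t - τ 0) + (∫ s in (τ 0)..t, γ ‖w s‖)
            + ∑ᶠ k ∈ {k : ℕ | τ 0 < τ k ∧ τ k ≤ t}, γ ‖Function.leftLim w (τ k)‖

end System

end

/-! Write `V = V₁ + V₂`, let `Γ(t)` be the integral of `χ ‖w‖` over `[t₀, t]` plus the values `χ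
‖w(t_k⁻)‖` at the impulses up to `t`, and put `q = ρ₁ + ρ₂ + (1 - ρ₁) κ`.

Between impulses the Dini inequality lets `V` grow by at most the factor `e^{μδ}`, up to `e^J` and
an additive `J`, where `J` is the input integral over the interval (`le_exp_mul_of_dini_le`). At an
impulse only `V₁` jumps, since `V₂` is continuous along trajectories. From `ρ₁ V₁ + V₂ = ρ₁ (V₁ +
V₂) + (1 - ρ₁) V₂` and (iii), (iv), the new value of `V` is at most `q S + χ ‖w(t_k⁻)‖`, where `S`
bounds `V₁` on the preceding window of length `r` and the left limit of `V` at its end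
(`IsSolution.jump_le`). Condition (v) says `q e^{μδ} < 1`, with room for a small decay rate `c > 0`
such that `q e^{cr} ≤ e^{-(μ+c)δ}`; the factor `e^{cr}` pays for looking back by `r`. Induction over
the impulses gives `V(t) ≤ e^Γ (A e^{-c(t-t₀)} + e^{μδ} Γ)` (`IsSolution.lyapunov_le`). Since `1 + z
≤ e^z`, taking `log (1 + ·)` makes the factor `e^Γ` additive, which is the iISS estimate with `α =
log (1 + α₁)`.

Global existence rests on the same growth bound. With its argument clipped to a ball, the right-hand
side is globally Lipschitz and Picard iteration solves the equation on a whole interval between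
impulses; the bound on `V` keeps the solution inside a large enough ball, where the clipping does
nothing (`IsFlowLyapunov.exists_segment`). The pieces are then joined at the impulses. -/

open MeasureTheory

/-! ### Piecewise right-continuous functions and their histories. -/

section PiecewiseContinuous

variable {E G : Type*} [NormedAddCommGroup E] [NormedAddCommGroup G]

theorem IsPCOn.mono {g : ℝ → E} {a b a' b' : ℝ} (h : IsPCOn g a b) (ha : a ≤ a') (hb : b' ≤ b) :
    IsPCOn g a' b' where
  right_cont t ht := h.right_cont t ⟨ha.trans ht.1, ht.2.trans_le hb⟩
  left_lim t ht := h.left_lim t ⟨ha.trans_lt ht.1, ht.2.trans hb⟩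
  finite_disc := h.finite_disc.subset fun _ ht => ⟨⟨ha.trans_lt ht.1.1, ht.1.2.trans hb⟩, ht.2⟩

theorem IsPCOn.trans {g : ℝ → E} {a b c : ℝ} (h : IsPCOn g a b) (h' : IsPCOn g b c) :
    IsPCOn g a c where
  right_cont t ht := (lt_or_ge t b).elim (fun hb => h.right_cont t ⟨ht.1, hb⟩)
    fun hb => h'.right_cont t ⟨hb, ht.2⟩
  left_lim t ht := (le_or_gt t b).elim (fun hb => h.left_lim t ⟨ht.1, hb⟩)
    fun hb => h'.left_lim t ⟨hb, ht.2⟩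
  finite_disc := (h.finite_disc.union h'.finite_disc).subset fun t ht =>
    (le_or_gt t b).elim (fun hb => Or.inl ⟨⟨ht.1.1, hb⟩, ht.2⟩)
      fun hb => Or.inr ⟨⟨hb, ht.1.2⟩, ht.2⟩

theorem IsPCOn.congr {g g' : ℝ → E} {a b : ℝ} (h : IsPCOn g a b) (hg : EqOn g' g (Icc a b)) :
    IsPCOn g' a b := by
  have hR : ∀ t ∈ Ico a b, g =ᶠ[𝓝[>] t] g' := fun t ht => by
    filter_upwards [Ioo_mem_nhdsGT ht.2] with u hu
    exact (hg ⟨ht.1.trans hu.1.le, hu.2.le⟩).symm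
  have hL : ∀ t ∈ Ioc a b, g =ᶠ[𝓝[<] t] g' := fun t ht => by
    filter_upwards [Ioo_mem_nhdsLT ht.1] with u hu
    exact (hg ⟨hu.1.le, hu.2.le.trans ht.2⟩).symm
  refine ⟨fun t ht => ?_, fun t ht => ?_, h.finite_disc.subset ?_⟩
  · rw [hg (Ico_subset_Icc_self ht)]
    exact (h.right_cont t ht).congr' (hR t ht)
  · obtain ⟨l, hl⟩ := h.left_lim t ht
    exact ⟨l, hl.congr' (hL t ht)⟩
  · rintro t ⟨ht, hn⟩
    refine ⟨ht, fun hc => hn ?_⟩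
    rw [hg (Ioc_subset_Icc_self ht)]
    exact hc.congr' (hL t ht)

theorem IsPCOn.comp {g : ℝ → E} {a b : ℝ} (h : IsPCOn g a b) {c : E → G} (hc : Continuous c) :
    IsPCOn (fun t => c (g t)) a b where
  right_cont t ht := (hc.tendsto _).comp (h.right_cont t ht)
  left_lim t ht := let ⟨l, hl⟩ := h.left_lim t ht; ⟨c l, (hc.tendsto _).comp hl⟩
  finite_disc := h.finite_disc.subset fun _ ht =>
    ⟨ht.1, fun hh => ht.2 ((hc.tendsto _).comp hh)⟩

theorem ContinuousOn.isPCOn {g : ℝ → E} {a b : ℝ} (h : ContinuousOn g (Icc a b)) :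
    IsPCOn g a b := by
  have hL : ∀ t ∈ Ioc a b, Tendsto g (𝓝[<] t) (𝓝 (g t)) := fun t ht =>
    (h t (Ioc_subset_Icc_self ht)).mono_left (by
      rw [← nhdsWithin_Ioo_eq_nhdsLT ht.1]
      exact nhdsWithin_mono _ fun u hu => ⟨hu.1.le, hu.2.le.trans ht.2⟩)
  refine ⟨fun t ht => (h t (Ico_subset_Icc_self ht)).mono_left ?_, fun t ht => ⟨_, hL t ht⟩, ?_⟩
  · rw [← nhdsWithin_Ioo_eq_nhdsGT ht.2]
    exact nhdsWithin_mono _ fun u hu => ⟨ht.1.trans hu.1.le, hu.2.le⟩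
  · convert finite_empty
    ext t
    simp only [mem_ofPred_eq, mem_empty_iff_false, iff_false, not_and, not_not]
    exact hL t

theorem isPCOn_of_le {g : ℝ → E} {a b : ℝ} (h : b ≤ a) : IsPCOn g a b where
  right_cont t ht := absurd (ht.1.trans_lt ht.2) h.not_gt
  left_lim t ht := absurd (ht.1.trans_le ht.2) h.not_gt
  finite_disc := by simp [Ioc_eq_empty h.not_gt]

theorem IsPCFrom.isPCOn {g : ℝ → E} {a : ℝ} (h : IsPCFrom g a) (b : ℝ) : IsPCOn g a b :=
  (lt_or_ge a b).elim (h b) isPCOn_of_le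

theorem IsPCFrom.mono {g : ℝ → E} {a a' : ℝ} (h : IsPCFrom g a) (ha : a ≤ a') : IsPCFrom g a' :=
  fun b _ => (h.isPCOn b).mono ha le_rfl

/-- Two functions that agree on `[a, b)`: a one-point change at `b` preserves piecewise
continuity. -/
theorem IsPCOn.congr_Ico {g g' : ℝ → E} {a b : ℝ} (h : IsPCOn g a b) (hg : EqOn g' g (Ico a b)) :
    IsPCOn g' a b := by
  have hR : ∀ t ∈ Ico a b, g =ᶠ[𝓝[>] t] g' := fun t ht => by
    filter_upwards [Ioo_mem_nhdsGT ht.2] with u hu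
    exact (hg ⟨ht.1.trans hu.1.le, hu.2⟩).symm
  have hL : ∀ t ∈ Ioc a b, g =ᶠ[𝓝[<] t] g' := fun t ht => by
    filter_upwards [Ioo_mem_nhdsLT ht.1] with u hu
    exact (hg ⟨hu.1.le, hu.2.trans_le ht.2⟩).symm
  refine ⟨fun t ht => ?_, fun t ht => ?_,
    (h.finite_disc.union (finite_singleton b)).subset ?_⟩
  · rw [hg ht]
    exact (h.right_cont t ht).congr' (hR t ht)
  · obtain ⟨l, hl⟩ := h.left_lim t ht
    exact ⟨l, hl.congr' (hL t ht)⟩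
  · rintro t ⟨ht, hn⟩
    rcases ht.2.eq_or_lt with rfl | hlt
    · exact Or.inr rfl
    · refine Or.inl ⟨ht, fun hc => hn ?_⟩
      rw [hg ⟨ht.1.le, hlt⟩]
      exact hc.congr' (hL t ht)

theorem IsPCOn.tendsto_leftLim {g : ℝ → E} {a b : ℝ} (h : IsPCOn g a b) {t : ℝ}
    (ht : t ∈ Ioc a b) : Tendsto g (𝓝[<] t) (𝓝 (Function.leftLim g t)) :=
  tendsto_leftLim_of_tendsto (h.left_lim t ht)

theorem leftLim_congr {g g' : ℝ → E} {t : ℝ} (h : g =ᶠ[𝓝[<] t] g') {l : E}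
    (hl : Tendsto g (𝓝[<] t) (𝓝 l)) : Function.leftLim g' t = Function.leftLim g t := by
  rw [leftLim_eq_of_tendsto hl,
    leftLim_eq_of_tendsto (hl.congr' h)]

/-- One-sided limits bound `g` near each point, separately on its left and its right; compactness of
`[a, b]` makes the bound global. -/
theorem IsPCOn.bounded {g : ℝ → E} {a b : ℝ} (h : IsPCOn g a b) :
    ∃ C, ∀ t ∈ Icc a b, ‖g t‖ ≤ C := by
  rcases lt_or_ge b a with hab | hab
  · exact ⟨0, by simp [Icc_eq_empty hab.not_ge]⟩
  rcases hab.eq_or_lt with rfl | hab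
  · exact ⟨‖g a‖, by simp⟩
  have key : ∀ (l : Filter ℝ) (z : E), Tendsto g l (𝓝 z) → ∃ C, ∀ᶠ u in l, ‖g u‖ ≤ C :=
    fun l z hz => ⟨‖z‖ + 1, (hz.norm.eventually_lt_const (lt_add_one _)).mono fun _ => le_of_lt⟩
  refine isCompact_Icc.induction_on (p := fun s => ∃ C, ∀ t ∈ s, ‖g t‖ ≤ C) ⟨0, by simp⟩
    (fun s t hst ⟨C, hC⟩ => ⟨C, fun u hu => hC u (hst hu)⟩)
    (fun s t ⟨C, hC⟩ ⟨D, hD⟩ => ⟨max C D, fun u hu => hu.elim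
      (fun hu => (hC u hu).trans (le_max_left _ _)) fun hu => (hD u hu).trans (le_max_right _ _)⟩)
    fun t ht => ?_
  have hl : ∃ C, ∀ᶠ u in 𝓝[Icc a b ∩ Iio t] t, ‖g u‖ ≤ C := by
    rcases ht.1.eq_or_lt with rfl | hlt
    · refine ⟨0, ?_⟩
      rw [show Icc a b ∩ Iio a = ∅ from by ext u; simp; intro h1 _; exact h1]
      simp
    · obtain ⟨z, hz⟩ := h.left_lim t ⟨hlt, ht.2⟩
      exact key _ z (hz.mono_left (nhdsWithin_mono _ inter_subset_right))
  have hr : ∃ C, ∀ᶠ u in 𝓝[Icc a b ∩ Ioi t] t, ‖g u‖ ≤ C := by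
    rcases ht.2.eq_or_lt with rfl | hlt
    · refine ⟨0, ?_⟩
      rw [show Icc a t ∩ Ioi t = ∅ from by ext u; simp]
      simp
    · exact key _ _ ((h.right_cont t ⟨ht.1, hlt⟩).mono_left (nhdsWithin_mono _ inter_subset_right))
  obtain ⟨C, hC⟩ := hl
  obtain ⟨D, hD⟩ := hr
  refine ⟨{u | ‖g u‖ ≤ max (max C D) ‖g t‖}, ?_, max (max C D) ‖g t‖, fun u hu => hu⟩
  rw [eventually_nhdsWithin_iff] at hC hD
  rw [mem_nhdsWithin_iff_eventually]
  filter_upwards [hC, hD] with u h1 h2 hu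
  rcases lt_trichotomy u t with h3 | rfl | h3
  · exact (h1 ⟨hu, h3⟩).trans ((le_max_left _ _).trans (le_max_left _ _))
  · exact le_max_right _ _
  · exact (h2 ⟨hu, h3⟩).trans ((le_max_right _ _).trans (le_max_left _ _))

/-- Off the finite set of jumps, which is null, `g` is continuous on the open interval. -/
theorem IsPCOn.aestronglyMeasurable {g : ℝ → E} {a b : ℝ} (h : IsPCOn g a b) :
    AEStronglyMeasurable g (volume.restrict (Ioc a b)) := by
  set D := {t ∈ Ioc a b | ¬ Tendsto g (𝓝[<] t) (𝓝 (g t))} with hD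
  have hm : MeasurableSet (Ioo a b \ D) := measurableSet_Ioo.diff h.finite_disc.measurableSet
  have hc : ContinuousOn g (Ioo a b \ D) := fun t ht => by
    refine ContinuousAt.continuousWithinAt ?_
    have hl : Tendsto g (𝓝[<] t) (𝓝 (g t)) := by
      by_contra hn
      exact ht.2 ⟨Ioo_subset_Ioc_self ht.1, hn⟩
    rw [continuousAt_iff_continuous_left'_right']
    exact ⟨hl, h.right_cont t (Ioo_subset_Ico_self ht.1)⟩
  have he : (Ioo a b \ D : Set ℝ) =ᵐ[volume] Ioc a b :=
    (sdiff_null_ae_eq_self (h.finite_disc.measure_zero _)).trans Ioo_ae_eq_Ioc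
  rw [← Measure.restrict_congr_set he]
  exact hc.aestronglyMeasurable hm

theorem IsPCOn.intervalIntegrable {g : ℝ → E} {a b : ℝ} (h : IsPCOn g a b) (hab : a ≤ b) :
    IntervalIntegrable g volume a b := by
  rw [intervalIntegrable_iff_integrableOn_Ioc_of_le hab]
  obtain ⟨C, hC⟩ := h.bounded
  exact IntegrableOn.of_bound (C := C) (by simp) h.aestronglyMeasurable
    ((ae_restrict_mem measurableSet_Ioc).mono fun t ht => hC t (Ioc_subset_Icc_self ht))

theorem IsPCOn.hasDerivWithinAt_integral [NormedSpace ℝ E] [CompleteSpace E] {g : ℝ → E}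
    {a b t : ℝ} (h : IsPCOn g a b) (ht : t ∈ Ico a b) :
    HasDerivWithinAt (fun u => ∫ s in a..u, g s) (g t) (Ici t) t := by
  refine intervalIntegral.integral_hasDerivWithinAt_right
    ((h.mono le_rfl ht.2.le).intervalIntegrable ht.1) (t := Ioi t) ?_ (h.right_cont t ht)
  refine ⟨Ioc t b, Ioc_mem_nhdsGT ht.2, ?_⟩
  exact (h.mono ht.1 le_rfl).aestronglyMeasurable

theorem IsPCOn.continuousOn_integral [NormedSpace ℝ E] {g : ℝ → E}
    {a b : ℝ} (h : IsPCOn g a b) (hab : a ≤ b) :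
    ContinuousOn (fun u => ∫ s in a..u, g s) (Icc a b) := by
  have := intervalIntegral.continuousOn_primitive_interval' (h.intervalIntegrable hab)
    (left_mem_uIcc)
  rwa [uIcc_of_le hab] at this

/-- The function that is `g` on `[a, b]`, vanishes before `a` and is constant after `b`. -/
noncomputable def pcExtend (a b : ℝ) (g : ℝ → E) (t : ℝ) : E :=
  if t < a then 0 else g (min t b)

theorem pcExtend_eqOn {a b : ℝ} {g : ℝ → E} : EqOn (pcExtend a b g) g (Icc a b) := fun t ht => by
  simp [pcExtend, ht.1.not_gt, ht.2]

/-- `ClassNuStar` speaks only of functions on the half-line `[-r, ∞)`; this extension makes it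
applicable to solutions known on a bounded interval. -/
theorem IsPCOn.pcExtend {a b : ℝ} {g : ℝ → E} (h : IsPCOn g a b) (hab : a ≤ b) (c : ℝ) :
    IsPCFrom (pcExtend a b g) c := by
  intro d _
  have h1 : IsPCOn (_root_.pcExtend a b g) (min c a) a := by
    refine (continuousOn_const (c := (0 : E))).isPCOn.congr_Ico fun t ht => ?_
    simp [_root_.pcExtend, ht.2]
  have h2 : IsPCOn (_root_.pcExtend a b g) b (max b d) := by
    refine (continuousOn_const (c := g b)).isPCOn.congr fun t ht => ?_
    simp [_root_.pcExtend, (hab.trans ht.1).not_gt, ht.1]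
  exact ((h1.trans (h.congr pcExtend_eqOn)).trans h2).mono (min_le_left _ _) (le_max_right _ _)

variable {r : ℝ}

theorem history_apply {x : ℝ → E} {t s : ℝ} (h : IsPCOn x (t - r) t) (hs : s ∈ Icc (-r) 0) :
    history r x t s = x (t + s) := by
  simp only [history, dif_pos h]
  exact indicator_of_mem hs _

theorem PCHist.ext_Icc {φ ψ : PCHist E r} (h : ∀ s ∈ Icc (-r) 0, φ s = ψ s) : φ = ψ := by
  ext s
  by_cases hs : s ∈ Icc (-r) 0
  · exact h s hs
  · rw [φ.eq_zero s hs, ψ.eq_zero s hs]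

theorem history_congr {x y : ℝ → E} {t : ℝ} (h : EqOn x y (Icc (t - r) t)) :
    history r x t = history r y t := by
  by_cases hx : IsPCOn x (t - r) t
  · have hy : IsPCOn y (t - r) t := hx.congr h.symm
    refine PCHist.ext_Icc fun s hs => ?_
    rw [history_apply hx hs, history_apply hy hs]
    exact h ⟨by linarith [hs.1], by linarith [hs.2]⟩
  · have hy : ¬ IsPCOn y (t - r) t := fun hy => hx (hy.congr h)
    simp [history, hx, hy]

theorem PCHist.bddAbove (φ : PCHist E r) :
    BddAbove (range fun s : Icc (-r) (0 : ℝ) => ‖φ s‖) := by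
  obtain ⟨C, hC⟩ := φ.isPC.bounded
  exact ⟨C, by rintro _ ⟨s, rfl⟩; exact hC s s.2⟩

theorem PCHist.norm_le_supNorm (φ : PCHist E r) {s : ℝ} (hs : s ∈ Icc (-r) 0) :
    ‖φ s‖ ≤ supNorm r φ :=
  le_ciSup φ.bddAbove (⟨s, hs⟩ : Icc (-r) (0 : ℝ))

theorem supNorm_nonneg (g : ℝ → E) : 0 ≤ supNorm r g :=
  Real.iSup_nonneg fun _ => norm_nonneg _

theorem supNorm_le {g : ℝ → E} {C : ℝ} (hC : 0 ≤ C) (h : ∀ s ∈ Icc (-r) 0, ‖g s‖ ≤ C) :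
    supNorm r g ≤ C :=
  Real.iSup_le (fun s => h s s.2) hC

theorem supNorm_history_le {x : ℝ → E} {t C : ℝ} (h : IsPCOn x (t - r) t) (hC : 0 ≤ C)
    (hx : ∀ s ∈ Icc (t - r) t, ‖x s‖ ≤ C) : supNorm r (history r x t) ≤ C :=
  supNorm_le hC fun s hs => by
    rw [history_apply h hs]
    exact hx _ ⟨by linarith [hs.1], by linarith [hs.2]⟩

end PiecewiseContinuous

/-! ### Picard iteration for Volterra equations. -/

section Volterra

variable {E : Type*} [NormedAddCommGroup E] [NormedSpace ℝ E] [CompleteSpace E]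

open scoped Nat in
/-- Picard iteration for Volterra integral equations `y(t) = c + ∫ₐᵗ Φ(y)(s) ds` whose right-hand
side at time `t` depends in a Lipschitz way on the values of `y` on `[a, t]`. -/
theorem volterra_existsUnique {a b : ℝ} (hab : a ≤ b) (c : E) (Φ : C(Icc a b, E) → ℝ → E)
    (hΦ : ∀ y, IntervalIntegrable (Φ y) volume a b) {K : ℝ} (hK : 0 ≤ K)
    (hL : ∀ (y z : C(Icc a b, E)) (t : ℝ), t ∈ Icc a b → ∀ C, 0 ≤ C →
      (∀ s : Icc a b, (s : ℝ) ≤ t → ‖y s - z s‖ ≤ C) → ‖Φ y t - Φ z t‖ ≤ K * C) :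
    ∃! y : C(Icc a b, E), ∀ t : Icc a b, y t = c + ∫ s in a..t, Φ y s := by
  have hsub : ∀ y (t : Icc a b), IntervalIntegrable (Φ y) volume a t := fun y t =>
    (hΦ y).mono_set (by rw [uIcc_of_le t.2.1, uIcc_of_le hab]; exact Icc_subset_Icc_right t.2.2)
  let P : C(Icc a b, E) → C(Icc a b, E) := fun y =>
    ⟨fun t => c + ∫ s in a..t, Φ y s, by
      have := intervalIntegral.continuousOn_primitive_interval' (hΦ y) left_mem_uIcc
      rw [uIcc_of_le hab] at this
      exact continuous_const.add (continuousOn_iff_continuous_domRestrict.1 this)⟩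
  have hP : ∀ y t, P y t = c + ∫ s in a..t, Φ y s := fun _ _ => rfl
  -- Because `Φ y` at time `t` sees only the past of `y`, each iteration integrates the previous
  -- bound once more, which produces the factorial.
  have hit : ∀ (n : ℕ) (y z : C(Icc a b, E)) (t : Icc a b),
      ‖P^[n] y t - P^[n] z t‖ ≤ (K * (t - a)) ^ n / n ! * dist y z := by
    intro n y z
    induction n with
    | zero => intro t; simpa [dist_eq_norm] using ContinuousMap.dist_apply_le_dist (f := y) (g := z) t
    | succ n ih =>
      intro t
      rw [Function.iterate_succ_apply', Function.iterate_succ_apply', hP, hP,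
        add_sub_add_left_eq_sub, ← intervalIntegral.integral_sub (hsub _ t) (hsub _ t)]
      have hb : ∀ s ∈ Ioc a (t : ℝ), ‖Φ (P^[n] y) s - Φ (P^[n] z) s‖ ≤
          K ^ (n + 1) / n ! * dist y z * (s - a) ^ n := by
        intro s hs
        refine (hL _ _ s ⟨hs.1.le, hs.2.trans t.2.2⟩ ((K * (s - a)) ^ n / n ! * dist y z)
          ?_ fun u hu => (ih u).trans ?_).trans_eq ?_
        · have := sub_nonneg.2 hs.1.le
          positivity
        · have := sub_nonneg.2 u.2.1
          gcongr
        · rw [mul_pow]; ring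
      refine (intervalIntegral.norm_integral_le_of_norm_le t.2.1
        (Eventually.of_forall hb)
        (Continuous.intervalIntegrable (by fun_prop) _ _)).trans_eq ?_
      rw [intervalIntegral.integral_const_mul,
        intervalIntegral.integral_comp_sub_right (fun u => u ^ n), integral_pow, sub_self,
        zero_pow (Nat.succ_ne_zero n), sub_zero, Nat.factorial_succ, mul_pow]
      push_cast
      field_simp
  -- Some iterate is a contraction whatever the length of the interval, so no subdivision is needed;
  -- its fixed point is also fixed by `P`.
  obtain ⟨n, hn⟩ := (FloorSemiring.tendsto_pow_div_factorial_atTop (K * (b - a))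
    |>.eventually (gt_mem_nhds zero_lt_one)).exists
  have h0 : (0 : ℝ) ≤ (K * (b - a)) ^ n / n ! := by
    have := sub_nonneg.2 hab
    positivity
  obtain ⟨q, hq⟩ : ∃ q : NNReal, (q : ℝ) = (K * (b - a)) ^ n / n ! := ⟨⟨_, h0⟩, rfl⟩
  have hcon : ContractingWith q P^[n] := by
    refine ⟨by rw [← NNReal.coe_lt_coe, hq]; exact hn, LipschitzWith.of_dist_le_mul fun y z => ?_⟩
    rw [ContinuousMap.dist_le (by positivity)]
    intro t
    rw [dist_eq_norm]
    refine (hit n y z t).trans ?_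
    have h1 := sub_nonneg.2 t.2.1
    have h2 := t.2.2
    rw [hq]
    gcongr
  have : Nonempty C(Icc a b, E) := ⟨0⟩
  refine ⟨hcon.fixedPoint _, fun t => ?_, fun z hz => ?_⟩
  · exact (DFunLike.congr_fun hcon.isFixedPt_fixedPoint_iterate t).symm
  · have hzP : Function.IsFixedPt P z := ContinuousMap.ext fun t => (hz t).symm
    exact hcon.fixedPoint_unique (hzP.iterate n)

end Volterra

/-! ### Radial clipping to a ball. -/

section RadialClip

variable {E : Type*} [NormedAddCommGroup E] [NormedSpace ℝ E]

/-- Radial projection onto the ball of radius `R`. -/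
noncomputable def radialClip (R : ℝ) (v : E) : E := (R / max R ‖v‖) • v

theorem radialClip_of_norm_le {R : ℝ} (hR : 0 < R) {v : E} (hv : ‖v‖ ≤ R) :
    radialClip R v = v := by
  rw [radialClip, max_eq_left hv, div_self hR.ne', one_smul]

theorem norm_radialClip_le {R : ℝ} (hR : 0 < R) (v : E) : ‖radialClip R v‖ ≤ R := by
  have hm : 0 < max R ‖v‖ := hR.trans_le (le_max_left _ _)
  rw [radialClip, norm_smul, Real.norm_of_nonneg (by positivity), div_mul_eq_mul_div,
    div_le_iff₀ hm]
  exact mul_le_mul_of_nonneg_left (le_max_right _ _) hR.le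

/-- Moving the vector and changing the scaling factor each cost at most `‖u - v‖`. The resulting
constant 2 holds in every real normed space, without an inner product. -/
theorem norm_radialClip_sub_le {R : ℝ} (hR : 0 < R) (u v : E) :
    ‖radialClip R u - radialClip R v‖ ≤ 2 * ‖u - v‖ := by
  set p := max R ‖u‖ with hp
  set q := max R ‖v‖ with hq
  have hp0 : 0 < p := hR.trans_le (le_max_left _ _)
  have hq0 : 0 < q := hR.trans_le (le_max_left _ _)
  have e : radialClip R u - radialClip R v = (R / p) • (u - v) + (R / p - R / q) • v := by
    simp only [radialClip, ← hp, ← hq]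
    module
  have h1 : ‖(R / p) • (u - v)‖ ≤ ‖u - v‖ := by
    rw [norm_smul, Real.norm_of_nonneg (by positivity)]
    exact mul_le_of_le_one_left (norm_nonneg _) ((div_le_one hp0).2 (le_max_left _ _))
  have h2 : ‖(R / p - R / q) • v‖ ≤ ‖u - v‖ := by
    have e2 : R / p - R / q = (R / p) * ((q - p) / q) := by field_simp
    have hqp : |q - p| ≤ ‖u - v‖ := by
      have := abs_max_sub_max_le_max R ‖v‖ R ‖u‖
      rw [sub_self, abs_zero, max_eq_right (abs_nonneg (‖v‖ - ‖u‖))] at this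
      exact this.trans ((abs_norm_sub_norm_le v u).trans_eq (norm_sub_rev _ _))
    rw [norm_smul, e2, Real.norm_eq_abs, abs_mul, abs_of_nonneg (by positivity : 0 ≤ R / p),
      abs_div, abs_of_pos hq0]
    calc R / p * (|q - p| / q) * ‖v‖ ≤ 1 * (‖u - v‖ / q) * q := by
          gcongr
          · exact (div_le_one hp0).2 (le_max_left _ _)
          · exact le_max_right _ _
      _ = ‖u - v‖ := by field_simp
  rw [e]
  exact (norm_add_le _ _).trans (by linarith)

theorem continuous_radialClip {R : ℝ} (hR : 0 < R) : Continuous (radialClip R : E → E) :=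
  (LipschitzWith.of_dist_le_mul (K := 2) fun u v => by
    simpa [dist_eq_norm] using norm_radialClip_sub_le hR u v).continuous

end RadialClip

/-! ### The impulse-free delay equation on one interval. -/

section Segment

set_option linter.unusedSectionVars false

variable {E F : Type*} [NormedAddCommGroup E] [NormedSpace ℝ E] [NormedAddCommGroup F]

/-- `x` solves the impulse-free equation on `[a, b]`, and is continuous up to the end point. -/
structure IsSegment (r : ℝ) (f : ℝ → PCHist E r → F → E) (w : ℝ → F) (a b : ℝ) (x : ℝ → E) :
    Prop where
  isPC : IsPCOn x (a - r) b
  cont : ContinuousOn x (Icc a b)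
  deriv : ∀ t ∈ Ico a b, HasDerivWithinAt x (f t (history r x t) (w t)) (Ici t) t

variable {r : ℝ} {f : ℝ → PCHist E r → F → E} {w : ℝ → F} {a b : ℝ} {x y ψ : ℝ → E}

theorem HasDerivWithinAt.congr_Ici {z : E} {t c : ℝ} (h : HasDerivWithinAt x z (Ici t) t)
    (htc : t < c) (hxy : EqOn y x (Ico t c)) : HasDerivWithinAt y z (Ici t) t := by
  refine h.congr_of_eventuallyEq ?_ (hxy ⟨le_rfl, htc⟩)
  filter_upwards [Ico_mem_nhdsGE htc] with u hu using hxy hu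

/-- The Dini hypothesis is stated for flows started at `t`; restarting a segment at each of its
times makes it available along the whole segment. -/
theorem IsSegment.isFlow (h : IsSegment r f w a b x) {t : ℝ} (ht : t ∈ Ico a b) :
    IsFlow r f w t (history r x t) b x where
  init s hs := (history_apply (h.isPC.mono (by linarith [ht.1]) ht.2.le) hs).symm
  cont := h.cont.mono fun u hu => ⟨ht.1.trans hu.1, hu.2.le⟩
  deriv u hu := h.deriv u ⟨ht.1.trans hu.1, hu.2⟩

/-- The function that is `ψ` before `a` and follows `y` on `[a, b]`. -/
noncomputable def glueAt (hab : a ≤ b) (ψ : ℝ → E) (y : C(Icc a b, E)) (t : ℝ) : E :=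
  if t < a then ψ t else y (projIcc a b hab t)

theorem glueAt_of_lt {hab : a ≤ b} {y : C(Icc a b, E)} {t : ℝ} (ht : t < a) :
    glueAt hab ψ y t = ψ t := if_pos ht

theorem glueAt_of_mem {hab : a ≤ b} {y : C(Icc a b, E)} {t : ℝ} (ht : t ∈ Icc a b) :
    glueAt hab ψ y t = y ⟨t, ht⟩ := by
  rw [glueAt, if_neg ht.1.not_gt, projIcc_of_mem hab ht]

theorem continuousOn_glueAt {hab : a ≤ b} {y : C(Icc a b, E)} :
    ContinuousOn (glueAt hab ψ y) (Icc a b) := by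
  refine (y.continuous.comp (continuous_projIcc (h := hab))).continuousOn.congr fun t ht => ?_
  rw [glueAt, if_neg ht.1.not_gt]
  rfl

theorem isPCOn_glueAt (hab : a ≤ b) (hψ : IsPCOn ψ (a - r) a) (y : C(Icc a b, E)) :
    IsPCOn (glueAt hab ψ y) (a - r) b :=
  (hψ.congr_Ico fun _ ht => glueAt_of_lt ht.2).trans continuousOn_glueAt.isPCOn

theorem RegularRHS.isPCOn (hf : RegularRHS r f) (ha : 0 ≤ a) (hab : a < b) (hw : IsPCFrom w a)
    (hx : IsPCOn x (a - r) b) : IsPCOn (fun t => f t (history r x t) (w t)) a b :=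
  hf.compositePC a w ha hw b x hab hx

variable [CompleteSpace E]

/-- Clipped histories all have norm at most `R`, so the local Lipschitz constant for that ball
serves every `y`. The common prehistory `ψ` cancels in differences, leaving a Volterra dependence on
`y` alone. -/
theorem RegularRHS.clipped_existsUnique (hf : RegularRHS r f) (ha : 0 ≤ a)
    (hab : a < b) (hw : IsPCFrom w a) (hψ : IsPCOn ψ (a - r) a) {R : ℝ} (hR : 0 < R) :
    ∃! y : C(Icc a b, E), ∀ t : Icc a b, y t = ψ a + ∫ s in a..t,
      f s (history r (fun u => radialClip R (glueAt hab.le ψ y u)) s) (w s) := by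
  have hpc : ∀ y : C(Icc a b, E), IsPCOn (fun u => radialClip R (glueAt hab.le ψ y u)) (a - r) b :=
    fun y => (isPCOn_glueAt hab.le hψ y).comp (continuous_radialClip hR)
  obtain ⟨L, hL⟩ := hf.locallyLipschitz a w ha hw b R
  refine volterra_existsUnique hab.le (ψ a) _
    (fun y => (hf.isPCOn ha hab hw (hpc y)).intervalIntegrable hab.le)
    (K := max L 0 * 2) (by positivity) fun y z t ht C hC hyz => ?_
  have hpct : ∀ y : C(Icc a b, E),
      IsPCOn (fun u => radialClip R (glueAt hab.le ψ y u)) (t - r) t :=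
    fun y => (hpc y).mono (by linarith [ht.1]) ht.2
  have hn : ∀ y : C(Icc a b, E),
      supNorm r (history r (fun u => radialClip R (glueAt hab.le ψ y u)) t) ≤ R :=
    fun y => supNorm_history_le (hpct y) hR.le fun s _ => norm_radialClip_le hR _
  refine (hL t ht _ _ (hn y) (hn z)).trans ?_
  rw [mul_assoc]
  refine mul_le_mul (le_max_left _ _) ?_ (supNorm_nonneg _) (le_max_right _ _)
  refine supNorm_le (by positivity) fun s hs => ?_
  rw [history_apply (hpct y) hs, history_apply (hpct z) hs]
  refine (norm_radialClip_sub_le hR _ _).trans ?_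
  gcongr
  rcases lt_or_ge (t + s) a with h | h
  · rw [glueAt_of_lt h, glueAt_of_lt h, sub_self, norm_zero]
    exact hC
  · have hm : t + s ∈ Icc a b := ⟨h, by linarith [hs.2, ht.2]⟩
    rw [glueAt_of_mem hm, glueAt_of_mem hm]
    exact hyz _ (by simpa using hs.2)

theorem RegularRHS.exists_clipped (hf : RegularRHS r f) (ha : 0 ≤ a)
    (hab : a < b) (hw : IsPCFrom w a) (hψ : IsPCOn ψ (a - r) a) {R : ℝ} (hR : 0 < R) :
    ∃ x : ℝ → E, EqOn x ψ (Iic a) ∧ IsPCOn x (a - r) b ∧ ContinuousOn x (Icc a b) ∧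
      ∀ t ∈ Ico a b, HasDerivWithinAt x
        (f t (history r (fun u => radialClip R (x u)) t) (w t)) (Ici t) t := by
  obtain ⟨y, hy, -⟩ := hf.clipped_existsUnique ha hab hw hψ hR
  have hpc := isPCOn_glueAt hab.le hψ y
  have hg := hf.isPCOn ha hab hw (hpc.comp (continuous_radialClip hR))
  refine ⟨glueAt hab.le ψ y, fun t ht => ?_, hpc, continuousOn_glueAt, fun t ht => ?_⟩
  · rcases (mem_Iic.1 ht).lt_or_eq with h | rfl
    · exact glueAt_of_lt h
    · rw [glueAt_of_mem ⟨le_rfl, hab.le⟩, hy]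
      simp
  · refine ((hg.hasDerivWithinAt_integral ht).const_add (ψ a)).congr_Ici ht.2 fun u hu => ?_
    rw [glueAt_of_mem ⟨ht.1.trans hu.1, hu.2.le⟩, hy]

/-- A solution bounded by `R` is unaffected by the clipping, so it solves the clipped integral
equation. The fundamental theorem of calculus needs only continuity and the right-hand derivative.
-/
theorem IsSegment.exists_clipped (hf : RegularRHS r f) (hr : 0 ≤ r) (ha : 0 ≤ a) (hab : a < b)
    (hw : IsPCFrom w a) (hx : IsSegment r f w a b x) {R : ℝ} (hR : 0 < R)
    (hxR : ∀ t ∈ Icc (a - r) b, ‖x t‖ ≤ R) (hψ : EqOn ψ x (Icc (a - r) a)) :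
    ∃ y : C(Icc a b, E), (∀ t : Icc a b, y t = x t) ∧ ∀ t : Icc a b, y t = ψ a + ∫ s in a..t,
      f s (history r (fun u => radialClip R (glueAt hab.le ψ y u)) s) (w s) := by
  refine ⟨⟨fun t => x t, continuousOn_iff_continuous_domRestrict.1 hx.cont⟩, fun t => rfl,
    fun t => ?_⟩
  set y : C(Icc a b, E) := ⟨fun t => x t, continuousOn_iff_continuous_domRestrict.1 hx.cont⟩
  have hg : EqOn (fun u => radialClip R (glueAt hab.le ψ y u)) x (Icc (a - r) b) := by
    intro u hu
    have : glueAt hab.le ψ y u = x u := by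
      rcases lt_or_ge u a with h | h
      · rw [glueAt_of_lt h]
        exact hψ ⟨hu.1, h.le⟩
      · rw [glueAt_of_mem ⟨h, hu.2⟩]
        rfl
    simp only [this]
    exact radialClip_of_norm_le hR (hxR u hu)
  have hI : ∫ s in a..t, f s (history r (fun u => radialClip R (glueAt hab.le ψ y u)) s) (w s) =
      ∫ s in a..t, f s (history r x s) (w s) := by
    refine intervalIntegral.integral_congr fun s hs => ?_
    rw [uIcc_of_le t.2.1] at hs
    rw [history_congr fun u hu => hg ⟨by linarith [hu.1, hs.1], hu.2.trans (hs.2.trans t.2.2)⟩]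
  have hint := ((hf.isPCOn ha hab hw hx.isPC).mono le_rfl t.2.2).intervalIntegrable t.2.1
  rw [hI, intervalIntegral.integral_eq_sub_of_hasDeriv_right_of_le t.2.1
    (hx.cont.mono (Icc_subset_Icc_right t.2.2))
    (fun s hs => (hx.deriv s ⟨hs.1.le, hs.2.trans_le t.2.2⟩).mono Ioi_subset_Ici_self) hint,
    hψ ⟨by linarith, le_rfl⟩]
  exact (add_sub_cancel _ _).symm

/-- Both solutions are bounded on the compact interval, hence both solve the clipped equation for
one common radius, and that equation has a single solution. -/
theorem IsSegment.eqOn (hf : RegularRHS r f) (hr : 0 ≤ r) (ha : 0 ≤ a) (hab : a < b)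
    (hw : IsPCFrom w a) (hx : IsSegment r f w a b x) (hy : IsSegment r f w a b y)
    (hxy : EqOn x y (Icc (a - r) a)) : EqOn x y (Icc (a - r) b) := by
  obtain ⟨C, hC⟩ := hx.isPC.bounded
  obtain ⟨D, hD⟩ := hy.isPC.bounded
  set R := max (max C D) 1 with hRdef
  have hR : 0 < R := zero_lt_one.trans_le (le_max_right _ _)
  obtain ⟨u, hu, hu'⟩ := hx.exists_clipped hf hr ha hab hw hR
    (fun t ht => (hC t ht).trans ((le_max_left _ _).trans (le_max_left _ _))) (eqOn_refl _ _)
  obtain ⟨v, hv, hv'⟩ := hy.exists_clipped hf hr ha hab hw hR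
    (fun t ht => (hD t ht).trans ((le_max_right _ _).trans (le_max_left _ _))) hxy
  have huv : u = v := (hf.clipped_existsUnique ha hab hw
    (hx.isPC.mono le_rfl hab.le) hR).unique hu' hv'
  intro t ht
  rcases le_or_gt t a with h | h
  · exact hxy ⟨ht.1, h⟩
  · rw [← hu ⟨t, h.le, ht.2⟩, huv, hv]

end Segment

/-! ### A Dini-derivative comparison principle. -/

section Comparison

/-- Comparison principle for the linear differential inequality `D⁺u ≤ (p + μ) u + p` with a
piecewise continuous coefficient `p`. -/
theorem le_exp_mul_of_dini_le {u p : ℝ → ℝ} {a b μ : ℝ} (hab : a ≤ b) (hμ : 0 ≤ μ)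
    (hu : ContinuousOn u (Icc a b)) (hu0 : 0 ≤ u a) (hp : IsPCOn p a b)
    (hp0 : ∀ t ∈ Icc a b, 0 ≤ p t)
    (hD : ∀ t ∈ Ico a b, limsup (fun h : ℝ => (((u (t + h) - u t) / h : ℝ) : EReal)) (𝓝[>] 0) ≤
      (((p t + μ) * u t + p t : ℝ) : EReal)) :
    ∀ t ∈ Icc a b, u t ≤ Real.exp ((∫ s in a..t, p s) + μ * (t - a)) *
      (u a + ∫ s in a..t, p s) := by
  have hP0 : ∀ t ∈ Icc a b, 0 ≤ ∫ s in a..t, p s := fun t ht =>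
    intervalIntegral.integral_nonneg ht.1 fun s hs => hp0 s ⟨hs.1, hs.2.trans ht.2⟩
  have hPc := hp.continuousOn_integral hab
  -- The comparison lemma needs a strict inequality of derivatives where `u` meets the bound `B`.
  -- The `ε` in the rate contributes `ε B`, and the `ε` in the initial value makes `B` positive even
  -- if `u a = 0`.
  have key : ∀ ε > 0, ∀ t ∈ Icc a b, u t ≤
      Real.exp ((∫ s in a..t, p s) + (μ + ε) * (t - a)) * (u a + ε + ∫ s in a..t, p s) := by
    intro ε hε
    refine image_le_of_liminf_slope_right_lt_deriv_boundary' (f' := fun t => (p t + μ) * u t + p t)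
      hu ?_ (by simp [hε.le]) ?_ (fun t ht => ?_) (B' := fun t =>
        Real.exp ((∫ s in a..t, p s) + (μ + ε) * (t - a)) * (p t + (μ + ε) * 1) *
          (u a + ε + ∫ s in a..t, p s) +
        Real.exp ((∫ s in a..t, p s) + (μ + ε) * (t - a)) * p t) ?_
    · intro t ht c hc
      have h1 := eventually_lt_of_limsup_lt ((hD t ht).trans_lt (EReal.coe_lt_coe_iff.2 hc))
      have h2 : Tendsto (fun z => z - t) (𝓝[>] t) (𝓝[>] 0) := by
        refine tendsto_nhdsWithin_iff.2 ⟨?_, ?_⟩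
        · have : Tendsto (fun z => z - t) (𝓝 t) (𝓝 (t - t)) :=
            (continuous_id.sub continuous_const).tendsto t
          rw [sub_self] at this
          exact this.mono_left nhdsWithin_le_nhds
        · filter_upwards [self_mem_nhdsWithin] with z hz using sub_pos.2 (mem_Ioi.1 hz)
      refine ((h2.eventually h1).mono fun z hz => ?_).frequently
      rw [slope_def_field]
      have := EReal.coe_lt_coe_iff.1 hz
      rwa [add_sub_cancel] at this
    · exact (Real.continuous_exp.comp_continuousOn (hPc.add (by fun_prop))).mul
        (continuousOn_const.add hPc)
    · have h1 := hp.hasDerivWithinAt_integral ht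
      have h2 : HasDerivWithinAt (fun t => (μ + ε) * (t - a)) ((μ + ε) * 1) (Ici t) t :=
        (((hasDerivAt_id t).sub_const a).const_mul (μ + ε)).hasDerivWithinAt
      exact (h1.add h2).exp.mul (h1.const_add (u a + ε))
    · intro t ht he
      have hm := Ico_subset_Icc_self ht
      have hP := hP0 t hm
      have hpt := hp0 t hm
      rw [he]
      set P := ∫ s in a..t, p s
      -- The derivative of the bound contains `p` times this exponential, which therefore dominates
      -- the free term `p`.
      have hE : 1 ≤ Real.exp (P + (μ + ε) * (t - a)) :=
        Real.one_le_exp (add_nonneg hP (mul_nonneg (by positivity) (sub_nonneg.2 ht.1)))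
      have h1 : 0 < Real.exp (P + (μ + ε) * (t - a)) * (u a + ε + P) :=
        mul_pos (Real.exp_pos _) (by linarith)
      have h2 := mul_le_mul_of_nonneg_right hE hpt
      have h3 := mul_pos hε h1
      linarith
  intro t ht
  have hc : Continuous fun ε => Real.exp ((∫ s in a..t, p s) + (μ + ε) * (t - a)) *
      (u a + ε + ∫ s in a..t, p s) := by fun_prop
  have := (hc.tendsto 0).mono_left (nhdsWithin_le_nhds (s := Ioi 0))
  simp only [add_zero] at this
  exact ge_of_tendsto this (by filter_upwards [self_mem_nhdsWithin] with ε hε using key ε hε t ht)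

end Comparison

/-! ### Growth of the functional between impulses, and existence on a whole interval. -/

section LyapunovEstimate

variable {E F : Type*} [NormedAddCommGroup E]

/-- Extending `x` by its end values gives a continuous function on the line, to which the half-line
definition applies. -/
theorem ClassNu.continuousOn {V₁ : ℝ → E → ℝ} (h : ClassNu V₁) {x : ℝ → E} {a b : ℝ}
    (ha : 0 ≤ a) (hab : a ≤ b) (hx : ContinuousOn x (Icc a b)) :
    ContinuousOn (fun t => V₁ t (x t)) (Icc a b) := by
  have hc : Continuous (fun t => x (projIcc a b hab t)) :=
    (continuousOn_iff_continuous_domRestrict.1 hx).comp continuous_projIcc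
  have h2 := (h _ fun c _ => hc.continuousOn.isPCOn).2
  have : ContinuousOn (fun t => V₁ t (x (projIcc a b hab t))) (Icc a b) := fun t ht =>
    (h2 t (ha.trans ht.1) hc.continuousWithinAt).mono fun u hu => ha.trans hu.1
  refine this.congr fun t ht => ?_
  simp only [projIcc_of_mem hab ht]

theorem ClassNuStar.continuousOn {r : ℝ} {V₂ : ℝ → PCHist E r → ℝ} (h : ClassNuStar r V₂)
    (hr : 0 ≤ r) {x : ℝ → E} {a b : ℝ} (ha : 0 ≤ a) (hab : a ≤ b) (hx : IsPCOn x (a - r) b) :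
    ContinuousOn (fun t => V₂ t (history r x t)) (Icc a b) := by
  refine ((h _ (hx.pcExtend (by linarith) (-r))).mono fun t ht => ha.trans ht.1).congr
    fun t ht => ?_
  rw [history_congr fun u hu => (pcExtend_eqOn (g := x)
    (⟨by linarith [hu.1, ht.1], hu.2.trans ht.2⟩ : u ∈ Icc (a - r) b)).symm]

variable [NormedSpace ℝ E] [NormedAddCommGroup F]

/-- `V₁ + V₂` is a nonnegative Lyapunov-Krasovskii functional with `D⁺V ≤ (χ + μ) V + χ` along the
impulse-free flow. -/
structure IsFlowLyapunov (r : ℝ) (f : ℝ → PCHist E r → F → E) (V₁ : ℝ → E → ℝ)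
    (V₂ : ℝ → PCHist E r → ℝ) (χ : ℝ → ℝ) (μ : ℝ) : Prop where
  nu : ClassNu V₁
  nuStar : ClassNuStar r V₂
  nonneg₁ : ∀ t, 0 ≤ t → ∀ x, 0 ≤ V₁ t x
  nonneg₂ : ∀ t, 0 ≤ t → ∀ φ, 0 ≤ V₂ t φ
  dini : ∀ t, 0 ≤ t → ∀ (φ : PCHist E r) (w : ℝ → F), IsPCFrom w t → ∀ (T : ℝ) (x : ℝ → E), t < T →
    IsFlow r f w t φ T x → upperDini r (fun s ψ => V₁ s (ψ 0) + V₂ s ψ) x t ≤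
      (((χ ‖w t‖ + μ) * (V₁ t (φ 0) + V₂ t φ) + χ ‖w t‖ : ℝ) : EReal)

variable {r : ℝ} {f : ℝ → PCHist E r → F → E} {V₁ : ℝ → E → ℝ} {V₂ : ℝ → PCHist E r → ℝ}
  {χ : ℝ → ℝ} {μ : ℝ} {w : ℝ → F} {a b : ℝ} {x : ℝ → E}

theorem ClassK.nonneg {α : ℝ → ℝ} (h : ClassK α) {s : ℝ} (hs : 0 ≤ s) : 0 ≤ α s :=
  h.map_zero ▸ h.strictMonoOn.monotoneOn (mem_Ici.2 le_rfl) hs hs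

theorem ClassK.continuous_comp_norm {α : ℝ → ℝ} (h : ClassK α) : Continuous fun v : F => α ‖v‖ :=
  h.continuousOn.comp_continuous continuous_norm fun v => norm_nonneg v

theorem IsFlowLyapunov.continuousOn (h : IsFlowLyapunov r f V₁ V₂ χ μ) (hr : 0 ≤ r) (ha : 0 ≤ a)
    (hab : a ≤ b) (hx : IsSegment r f w a b x) :
    ContinuousOn (fun t => V₁ t (x t) + V₂ t (history r x t)) (Icc a b) :=
  (h.nu.continuousOn ha hab hx.cont).add (h.nuStar.continuousOn hr ha hab hx.isPC)

theorem IsFlowLyapunov.le_exp_mul (h : IsFlowLyapunov r f V₁ V₂ χ μ) (hχ : ClassK χ) (hμ : 0 ≤ μ)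
    (hr : 0 ≤ r) (ha : 0 ≤ a) (hab : a ≤ b) (hw : IsPCFrom w a) (hx : IsSegment r f w a b x) :
    ∀ t ∈ Icc a b, V₁ t (x t) + V₂ t (history r x t) ≤
      Real.exp ((∫ s in a..t, χ ‖w s‖) + μ * (t - a)) *
        (V₁ a (x a) + V₂ a (history r x a) + ∫ s in a..t, χ ‖w s‖) := by
  have h0 : ∀ t ∈ Icc a b, history r x t 0 = x t := fun t ht => by
    rw [history_apply (hx.isPC.mono (by linarith [ht.1]) ht.2) ⟨by linarith, le_rfl⟩, add_zero]
  refine le_exp_mul_of_dini_le hab hμ (h.continuousOn hr ha hab hx)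
    (add_nonneg (h.nonneg₁ a ha _) (h.nonneg₂ a ha _))
    ((hw.isPCOn b).comp hχ.continuous_comp_norm) (fun t _ => hχ.nonneg (norm_nonneg _))
    fun t ht => ?_
  have h1 := h.dini t (ha.trans ht.1) _ w (hw.mono ht.1) b x ht.2 (hx.isFlow ht)
  rw [h0 t (Ico_subset_Icc_self ht)] at h1
  refine le_trans (le_of_eq (limsup_congr ?_)) h1
  filter_upwards [Ioo_mem_nhdsGT (sub_pos.2 ht.2)] with s hs
  rw [h0 t (Ico_subset_Icc_self ht), h0 (t + s) ⟨by linarith [hs.1, ht.1], by linarith [hs.2]⟩]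

variable [CompleteSpace E]

/-- While the clipped solution stays in the ball of radius `R` it solves the true equation, so the
growth bound gives `α₁ ‖x‖ ≤ B < α₁ R` and the solution cannot reach the sphere. -/
theorem IsFlowLyapunov.exists_segment (h : IsFlowLyapunov r f V₁ V₂ χ μ) (hχ : ClassK χ)
    (hμ : 0 ≤ μ) (hf : RegularRHS r f) {α₁ : ℝ → ℝ} (hα₁ : ClassKInf α₁)
    (hαV : ∀ t, 0 ≤ t → ∀ x, α₁ ‖x‖ ≤ V₁ t x) (hr : 0 ≤ r) (ha : 0 ≤ a) (hab : a < b)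
    (hw : IsPCFrom w a) {ψ : ℝ → E} (hψ : IsPCOn ψ (a - r) a) :
    ∃ x, IsSegment r f w a b x ∧ EqOn x ψ (Iic a) := by
  obtain ⟨C, hC⟩ := hψ.bounded
  set p : ℝ → ℝ := fun s => χ ‖w s‖ with hp
  have hpn : ∀ s, 0 ≤ p s := fun s => hχ.nonneg (norm_nonneg _)
  have hppc : IsPCOn p a b := (hw.isPCOn b).comp hχ.continuous_comp_norm
  -- `B` depends only on the initial data and the input, so `R` can be chosen after it.
  set B := Real.exp ((∫ s in a..b, p s) + μ * (b - a)) *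
        (V₁ a (ψ a) + V₂ a (history r ψ a) + ∫ s in a..b, p s) with hB
  obtain ⟨R, hRB, hRC⟩ : ∃ R, B < α₁ R ∧ max C 0 < R :=
    ((hα₁.tendsto_atTop.eventually_gt_atTop B).and (eventually_gt_atTop _)).exists
  have hR : 0 < R := (le_max_right _ _).trans_lt hRC
  obtain ⟨x, hxψ, hxpc, hxc, hxd⟩ := hf.exists_clipped ha hab hw hψ hR
  have hseg : ∀ c ∈ Icc a b, (∀ t ∈ Ico a c, ‖x t‖ ≤ R) → IsSegment r f w a c x := by
    intro c hc hcR
    refine ⟨hxpc.mono le_rfl hc.2, hxc.mono (Icc_subset_Icc_right hc.2), fun t ht => ?_⟩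
    have hd := hxd t ⟨ht.1, ht.2.trans_le hc.2⟩
    have he : history r (fun u => radialClip R (x u)) t = history r x t := by
      refine history_congr fun u hu => radialClip_of_norm_le hR ?_
      rcases le_or_gt u a with h' | h'
      · rw [hxψ h']
        exact (hC u ⟨by linarith [hu.1, ht.1], h'⟩).trans ((le_max_left _ _).trans hRC.le)
      · exact hcR u ⟨h'.le, hu.2.trans_lt ht.2⟩
    rwa [he] at hd
  have hxa : x a = ψ a := hxψ (mem_Iic.2 le_rfl)
  have hha : history r x a = history r ψ a := history_congr fun u hu => hxψ hu.2
  have hbd : ∀ c ∈ Icc a b, (∀ t ∈ Ico a c, ‖x t‖ ≤ R) → ‖x c‖ < R := by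
    intro c hc hcR
    have h1 := h.le_exp_mul hχ hμ hr ha hc.1 hw (hseg c hc hcR) c ⟨hc.1, le_rfl⟩
    have hint : ∫ s in a..c, p s ≤ ∫ s in a..b, p s :=
      intervalIntegral.integral_mono_interval le_rfl hc.1 hc.2
        (Eventually.of_forall hpn) (hppc.intervalIntegrable hab.le)
    have hV0 : 0 ≤ V₁ a (ψ a) + V₂ a (history r ψ a) := add_nonneg (h.nonneg₁ a ha _) (h.nonneg₂ a ha _)
    have hint0 : 0 ≤ ∫ s in a..c, p s := intervalIntegral.integral_nonneg hc.1 fun s _ => hpn s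
    have h2 : α₁ ‖x c‖ < α₁ R := by
      refine lt_of_le_of_lt ?_ hRB
      refine (hαV c (ha.trans hc.1) _).trans ((le_add_of_nonneg_right
        (h.nonneg₂ c (ha.trans hc.1) _)).trans (h1.trans ?_))
      rw [hxa, hha, hB]
      exact mul_le_mul (Real.exp_le_exp.2 (add_le_add hint
        (mul_le_mul_of_nonneg_left (sub_le_sub_right hc.2 a) hμ))) (by linarith)
        (add_nonneg hV0 hint0) (Real.exp_pos _).le
    exact (hα₁.strictMonoOn.lt_iff_lt (norm_nonneg _) hR.le).1 h2
  have hall : ∀ t ∈ Icc a b, ‖x t‖ < R := by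
    by_contra hcon
    push Not at hcon
    obtain ⟨t₀, ht₀, hRt⟩ := hcon
    -- Before the first time in `S` the norm is below `R`, so `hbd` applies at that time and
    -- contradicts membership in `S`.
    set S := {t ∈ Icc a b | R ≤ ‖x t‖} with hS
    have hScl : IsClosed S := hxc.norm.preimage_isClosed_of_isClosed isClosed_Icc isClosed_Ici
    have hSb : BddBelow S := ⟨a, fun t ht => ht.1.1⟩
    have hmem : sInf S ∈ S := hScl.csInf_mem ⟨t₀, ht₀, hRt⟩ hSb
    refine (hbd _ hmem.1 fun t ht => ?_).not_ge hmem.2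
    by_contra hlt
    push Not at hlt
    exact (csInf_le hSb ⟨⟨ht.1, ht.2.le.trans hmem.1.2⟩, hlt.le⟩).not_gt ht.2
  exact ⟨x, hseg b ⟨hab.le, le_rfl⟩ fun t ht => (hall t ⟨ht.1, ht.2.le⟩).le, hxψ⟩

end LyapunovEstimate

/-! ### Joining segments across impulses; existence and uniqueness. -/

section Concatenation

set_option linter.unusedSectionVars false

variable {E F : Type*} [NormedAddCommGroup E] [NormedSpace ℝ E] [NormedAddCommGroup F]

theorem leftLim_congr_Icc {x y : ℝ → E} {c t : ℝ} (hc : c < t) (h : EqOn x y (Icc c t)) :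
    Function.leftLim x t = Function.leftLim y t := by
  have he : x =ᶠ[𝓝[<] t] y := by
    filter_upwards [Ioo_mem_nhdsLT hc] with u hu using h ⟨hu.1.le, hu.2.le⟩
  by_cases hx : ∃ l, Tendsto x (𝓝[<] t) (𝓝 l)
  · obtain ⟨l, hl⟩ := hx
    rw [leftLim_eq_of_tendsto hl, leftLim_eq_of_tendsto (hl.congr' he)]
  · have hy : ¬ ∃ l, Tendsto y (𝓝[<] t) (𝓝 l) := fun ⟨l, hl⟩ => hx ⟨l, hl.congr' he.symm⟩
    rw [leftLim_eq_of_not_tendsto _ hx, leftLim_eq_of_not_tendsto _ hy, h ⟨hc.le, le_rfl⟩]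

theorem historyLeft_congr {x y : ℝ → E} {r t : ℝ} (hr : 0 < r) (h : EqOn x y (Icc (t - r) t)) :
    historyLeft r x t = historyLeft r y t := by
  rw [historyLeft, historyLeft, leftLim_congr_Icc (by linarith) h]
  refine history_congr fun u hu => ?_
  rcases eq_or_ne u t with rfl | hne
  · simp
  · rw [Function.update_of_ne hne, Function.update_of_ne hne, h hu]

theorem IsPCOn.comp_sub {g : ℝ → E} {a b : ℝ} (h : IsPCOn g a b) (c : ℝ) :
    IsPCOn (fun t => g (t - c)) (a + c) (b + c) := by
  have hc : ∀ t : ℝ, Tendsto (fun u => u - c) (𝓝 t) (𝓝 (t - c)) := fun t =>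
    (continuous_id.sub continuous_const).tendsto t
  have hR : ∀ t : ℝ, Tendsto (fun u => u - c) (𝓝[>] t) (𝓝[>] (t - c)) := fun t =>
    tendsto_nhdsWithin_iff.2 ⟨(hc t).mono_left nhdsWithin_le_nhds, by
      filter_upwards [self_mem_nhdsWithin] with u hu; simpa using hu⟩
  have hL : ∀ t : ℝ, Tendsto (fun u => u - c) (𝓝[<] t) (𝓝[<] (t - c)) := fun t =>
    tendsto_nhdsWithin_iff.2 ⟨(hc t).mono_left nhdsWithin_le_nhds, by
      filter_upwards [self_mem_nhdsWithin] with u hu; simpa using hu⟩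
  refine ⟨fun t ht => ?_, fun t ht => ?_, ?_⟩
  · exact (h.right_cont (t - c) ⟨by linarith [ht.1], by linarith [ht.2]⟩).comp (hR t)
  · obtain ⟨l, hl⟩ := h.left_lim (t - c) ⟨by linarith [ht.1], by linarith [ht.2]⟩
    exact ⟨l, hl.comp (hL t)⟩
  · refine (h.finite_disc.preimage ((sub_left_injective (b := c)).injOn)).subset ?_
    rintro t ⟨ht, hn⟩
    refine ⟨⟨by simp only; linarith [ht.1], by simp only; linarith [ht.2]⟩, fun hh => hn ?_⟩
    exact hh.comp (hL t)

/-- `x` solves the impulsive system on `[τ 0 - r, τ k]`, including the jump at `τ k`. -/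
structure IsSolutionUpTo (r : ℝ) (f : ℝ → PCHist E r → F → E) (I : ℕ → ℝ → PCHist E r → F → E)
    (τ : ℕ → ℝ) (φ : PCHist E r) (w : ℝ → F) (k : ℕ) (x : ℝ → E) : Prop where
  init : ∀ s ∈ Icc (-r) 0, x (τ 0 + s) = φ s
  isPC : IsPCOn x (τ 0 - r) (τ k)
  cont : ∀ t ∈ Ioo (τ 0) (τ k), (∀ j, 1 ≤ j → t ≠ τ j) → ContinuousAt x t
  deriv : ∀ t ∈ Ico (τ 0) (τ k), HasDerivWithinAt x (f t (history r x t) (w t)) (Ici t) t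
  jump : ∀ j, 1 ≤ j → j ≤ k → x (τ j) - Function.leftLim x (τ j) =
      I j (τ j) (historyLeft r x (τ j)) (Function.leftLim w (τ j))

variable {r : ℝ} {f : ℝ → PCHist E r → F → E} {I : ℕ → ℝ → PCHist E r → F → E}
  {τ : ℕ → ℝ} {φ : PCHist E r} {w : ℝ → F}

theorem IsSolutionUpTo.exists_succ (hr : 0 < r) (hτ : StrictMono τ) {k : ℕ} {x : ℝ → E}
    (hx : IsSolutionUpTo r f I τ φ w k x)
    (hseg : ∃ y, IsSegment r f w (τ k) (τ (k + 1)) y ∧ EqOn y x (Iic (τ k))) :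
    ∃ x', IsSolutionUpTo r f I τ φ w (k + 1) x' ∧ EqOn x' x (Iic (τ k)) := by
  obtain ⟨y, hy, hyx⟩ := hseg
  have h0k : τ 0 ≤ τ k := hτ.monotone (Nat.zero_le k)
  have hab : τ k < τ (k + 1) := hτ k.lt_succ_self
  set b := τ (k + 1) with hb
  -- The segment `y` is continuous up to `b`, so `y b` is the left limit and `history r y b` the
  -- left history that enter the jump. Values of `x'` after `b` play no role.
  set x' : ℝ → E := fun t => if t < b then y t else
    y b + I (k + 1) b (history r y b) (Function.leftLim w b) with hx'
  have hlt : ∀ t < b, x' t = y t := fun t ht => if_pos ht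
  have hle : EqOn x' x (Iic (τ k)) := fun t ht => by
    rw [hlt t ((mem_Iic.1 ht).trans_lt hab), hyx ht]
  have hnear : ∀ t < b, x' =ᶠ[𝓝 t] y := fun t ht => by
    filter_upwards [Iio_mem_nhds ht] with u hu using hlt u hu
  have hypc : IsPCOn y (τ 0 - r) b :=
    ((hx.isPC.congr fun t ht => hyx ht.2).trans
      (hy.isPC.mono (by linarith) le_rfl : IsPCOn y (τ k) b))
  have hyl : Tendsto y (𝓝[<] b) (𝓝 (y b)) := (hy.cont b ⟨hab.le, le_rfl⟩).mono_left (by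
    rw [← nhdsWithin_Ioo_eq_nhdsLT hab]
    exact nhdsWithin_mono _ Ioo_subset_Icc_self)
  have hl : Function.leftLim x' b = y b := leftLim_eq_of_tendsto (hyl.congr' (by
    filter_upwards [self_mem_nhdsWithin] with u hu using (hlt u hu).symm))
  have hhl : historyLeft r x' b = history r y b := by
    rw [historyLeft, hl]
    refine history_congr fun u hu => ?_
    rcases hu.2.eq_or_lt with rfl | hu'
    · simp
    · rw [Function.update_of_ne hu'.ne, hlt u hu']
  refine ⟨x', ⟨fun s hs => ?_, ?_, fun t ht hne => ?_, fun t ht => ?_, fun j hj hjk => ?_⟩, hle⟩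
  · rw [hle (mem_Iic.2 (by linarith [hs.2])), hx.init s hs]
  · exact hypc.congr_Ico fun t ht => hlt t ht.2
  · rcases lt_trichotomy t (τ k) with h | rfl | h
    · refine (hx.cont t ⟨ht.1, h⟩ hne).congr ?_
      filter_upwards [Iio_mem_nhds h] with u hu using (hle (mem_Iio.1 hu).le).symm
    · rcases Nat.eq_zero_or_pos k with rfl | hk
      · exact absurd ht.1 (lt_irrefl _)
      · exact absurd rfl (hne k hk)
    · exact ((hy.cont t ⟨h.le, ht.2.le⟩).continuousAt (Icc_mem_nhds h ht.2)).congr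
        (hnear t ht.2).symm
  · rcases lt_or_ge t (τ k) with h | h
    · rw [history_congr fun u hu => hle (mem_Iic.2 (hu.2.trans h.le))]
      exact (hx.deriv t ⟨ht.1, h⟩).congr_Ici h fun u hu => hle hu.2.le
    · rw [history_congr fun u hu => hlt u (hu.2.trans_lt ht.2)]
      exact (hy.deriv t ⟨h, ht.2⟩).congr_Ici ht.2 fun u hu => hlt u hu.2
  · rcases hjk.lt_or_eq with h | rfl
    · have hjk' : j ≤ k := Nat.lt_succ_iff.1 h
      have hτj := hτ.monotone hjk'
      have he : EqOn x' x (Iic (τ j)) := fun u hu => hle ((mem_Iic.1 hu).trans hτj)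
      rw [he (mem_Iic.2 le_rfl), leftLim_congr_Icc (sub_one_lt _) (he.mono Icc_subset_Iic_self),
        historyLeft_congr hr (he.mono Icc_subset_Iic_self)]
      exact hx.jump j hj hjk'
    · rw [← hb, hl, hhl]
      simp [hx']

/-- Each extension agrees with the previous one up to `τ k`, so the value at `t` can be read from
any stage with `t ≤ τ k`. Every clause of the definition involves only the past and an immediate
right neighbourhood, hence is inherited from a single stage. -/
theorem exists_isSolution (hr : 0 < r) (hτ : StrictMono τ) (hτ' : Tendsto τ atTop atTop)
    (hseg : ∀ k ψ, IsPCOn ψ (τ k - r) (τ k) →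
      ∃ y, IsSegment r f w (τ k) (τ (k + 1)) y ∧ EqOn y ψ (Iic (τ k))) :
    ∃ x, IsSolution r f I τ φ w ⊤ x := by
  have hstep : ∀ k x, IsSolutionUpTo r f I τ φ w k x →
      ∃ x', IsSolutionUpTo r f I τ φ w (k + 1) x' ∧ EqOn x' x (Iic (τ k)) := fun k x hx =>
    hx.exists_succ hr hτ (hseg k x
      (hx.isPC.mono (sub_le_sub_right (hτ.monotone (Nat.zero_le k)) r) le_rfl))
  choose! next hnext hnext_eq using hstep
  have h0 : IsSolutionUpTo r f I τ φ w 0 fun t => φ (t - τ 0) := by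
    refine ⟨fun s _ => by simp, ?_, fun t ht => ?_, fun t ht => ?_, fun j hj hj0 => ?_⟩
    · convert φ.isPC.comp_sub (τ 0) using 1 <;> ring
    · exact absurd (ht.1.trans ht.2) (lt_irrefl _)
    · exact absurd (ht.1.trans_lt ht.2) (lt_irrefl _)
    · omega
  let X : ℕ → ℝ → E := fun k => Nat.rec (fun t => φ (t - τ 0)) next k
  have hX : ∀ k, IsSolutionUpTo r f I τ φ w k (X k) := fun k => by
    induction k with
    | zero => exact h0
    | succ k ih => exact hnext k _ ih
  have hXe : ∀ k m, k ≤ m → EqOn (X m) (X k) (Iic (τ k)) := fun k m hkm => by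
    induction m, hkm using Nat.le_induction with
    | base => exact eqOn_refl _ _
    | succ m hm ih =>
      exact fun t ht => (hnext_eq m _ (hX m) ((mem_Iic.1 ht).trans (hτ.monotone hm))).trans (ih ht)
  have hex : ∀ t, ∃ k, t ≤ τ k := fun t => (hτ'.eventually_ge_atTop t).exists
  have hex' : ∀ t, ∃ k, t < τ k := fun t => (hτ'.eventually_gt_atTop t).exists
  classical
  have hx : ∀ k, EqOn (fun t => X (Nat.find (hex t)) t) (X k) (Iic (τ k)) := fun k t ht =>
    (hXe _ k (Nat.find_min' (hex t) ht) (Nat.find_spec (hex t))).symm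
  set x : ℝ → E := fun t => X (Nat.find (hex t)) t
  have hxI : ∀ {k t}, t ≤ τ k → EqOn x (X k) (Iic t) := fun h u hu => hx _ ((mem_Iic.1 hu).trans h)
  refine ⟨x, fun s hs => ?_, fun b _ _ => ?_, fun t ht _ hne => ?_, fun t ht _ => ?_,
    fun k hk _ => ?_⟩
  · rw [hx 0 (mem_Iic.2 (by linarith [hs.2]))]
    exact (hX 0).init s hs
  · obtain ⟨k, hk⟩ := hex b
    exact ((hX k).isPC.mono le_rfl hk).congr ((hxI hk).mono Icc_subset_Iic_self)
  · obtain ⟨k, hk⟩ := hex' t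
    refine ((hX k).cont t ⟨ht, hk⟩ hne).congr ?_
    filter_upwards [Iio_mem_nhds hk] with u hu using (hx k (mem_Iio.1 hu).le).symm
  · obtain ⟨k, hk⟩ := hex' t
    rw [history_congr ((hxI hk.le).mono Icc_subset_Iic_self)]
    exact ((hX k).deriv t ⟨ht, hk⟩).congr_Ici hk fun u hu => hx k hu.2.le
  · rw [hx k (mem_Iic.2 le_rfl),
      leftLim_congr_Icc (sub_one_lt _) ((hx k).mono Icc_subset_Iic_self),
      historyLeft_congr hr ((hx k).mono Icc_subset_Iic_self)]
    exact (hX k).jump k hk le_rfl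

theorem StrictMono.ne_of_mem_Ioo (hτ : StrictMono τ) {k : ℕ} {t : ℝ}
    (ht : t ∈ Ioo (τ k) (τ (k + 1))) (j : ℕ) : t ≠ τ j := by
  rintro rfl
  have h1 := hτ.lt_iff_lt.1 ht.1
  have h2 := hτ.lt_iff_lt.1 ht.2
  omega

theorem IsSolution.isSegment {T : EReal} {x : ℝ → E} (hx : IsSolution r f I τ φ w T x)
    (hτ : StrictMono τ) {k : ℕ} {b : ℝ} (hkb : τ k < b) (hbk : b < τ (k + 1))
    (hbT : (b : EReal) < T) : IsSegment r f w (τ k) b x := by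
  have h0k : τ 0 ≤ τ k := hτ.monotone (Nat.zero_le k)
  have hT : ∀ t ≤ b, (t : EReal) < T := fun t ht => (EReal.coe_le_coe_iff.2 ht).trans_lt hbT
  refine ⟨(hx.isPC b (h0k.trans_lt hkb) hbT).mono (by linarith) le_rfl, fun t ht => ?_,
    fun t ht => hx.deriv t (h0k.trans ht.1) (hT t ht.2.le)⟩
  rcases ht.1.eq_or_lt with rfl | h
  · exact (hx.deriv _ h0k (hT _ hkb.le)).continuousWithinAt.mono fun u hu => hu.1
  · exact (hx.cont t (h0k.trans_lt h) (hT t ht.2) fun j _ =>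
      hτ.ne_of_mem_Ioo ⟨h, ht.2.trans_lt hbk⟩ j).continuousWithinAt

theorem IsSolution.tendsto_leftLim {x : ℝ → E} (hx : IsSolution r f I τ φ w ⊤ x)
    {t : ℝ} (ht : τ 0 < t) (hr : 0 ≤ r) :
    Tendsto x (𝓝[<] t) (𝓝 (Function.leftLim x t)) :=
  (hx.isPC t ht (EReal.coe_lt_top t)).tendsto_leftLim ⟨by linarith, le_rfl⟩

/-- Replacing the value after the jump by the left limit gives a segment on the closed interval, so
that estimates between impulses reach the instant just before the next one. -/
theorem IsSolution.isSegment_update {x : ℝ → E} (hx : IsSolution r f I τ φ w ⊤ x) (hr : 0 ≤ r)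
    (hτ : StrictMono τ) (k : ℕ) : IsSegment r f w (τ k) (τ (k + 1))
      (Function.update x (τ (k + 1)) (Function.leftLim x (τ (k + 1)))) := by
  have h0k : τ 0 ≤ τ k := hτ.monotone (Nat.zero_le k)
  have hab : τ k < τ (k + 1) := hτ k.lt_succ_self
  have hu : ∀ t < τ (k + 1), Function.update x (τ (k + 1)) (Function.leftLim x (τ (k + 1))) t =
      x t := fun t ht => Function.update_of_ne ht.ne _ _
  refine ⟨((hx.isPC _ (h0k.trans_lt hab) (EReal.coe_lt_top _)).congr_Ico
    fun t ht => hu t ht.2).mono (by linarith) le_rfl, fun t ht => ?_, fun t ht => ?_⟩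
  · rcases ht.2.eq_or_lt with rfl | h
    · rw [continuousWithinAt_update_same]
      refine (hx.tendsto_leftLim (h0k.trans_lt hab) hr).mono_left (nhdsWithin_mono _ ?_)
      exact fun u hu => lt_of_le_of_ne hu.1.2 hu.2
    · obtain ⟨b, htb, hb⟩ := exists_between h
      have := (hx.isSegment hτ (ht.1.trans_lt htb) hb (EReal.coe_lt_top _)).cont t ⟨ht.1, htb.le⟩
      refine (this.mono_of_mem_nhdsWithin ?_).congr_of_eventuallyEq ?_ (hu t h)
      · filter_upwards [self_mem_nhdsWithin, mem_nhdsWithin_of_mem_nhds (Iio_mem_nhds htb)]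
          with u h1 h2 using ⟨h1.1, h2.le⟩
      · filter_upwards [mem_nhdsWithin_of_mem_nhds (Iio_mem_nhds h)] with u h1 using hu u h1
  · rw [history_congr (y := x) fun u h => hu u (h.2.trans_lt ht.2)]
    exact (hx.deriv t (h0k.trans ht.1) (EReal.coe_lt_top _)).congr_Ici ht.2 fun u h => hu u h.2

/-- Induction over the impulses: agreement before an impulse forces equal left limits and equal left
histories, hence equal values after the jump. -/
theorem IsSolution.eq_of_lt [CompleteSpace E] {T : EReal} {x y : ℝ → E}
    (hf : RegularRHS r f) (hr : 0 < r)
    (hτ0 : 0 ≤ τ 0) (hτ : StrictMono τ) (hτ' : Tendsto τ atTop atTop) (hw : IsPCFrom w (τ 0))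
    (hx : IsSolution r f I τ φ w ⊤ x) (hy : IsSolution r f I τ φ w T y) {t : ℝ}
    (ht : τ 0 - r ≤ t) (htT : (t : EReal) < T) : y t = x t := by
  obtain ⟨k, hk⟩ := (hτ'.eventually_ge_atTop t).exists
  induction k generalizing t with
  | zero =>
    have hs : t - τ 0 ∈ Icc (-r) 0 := ⟨by linarith, by linarith⟩
    have h1 := hx.init _ hs
    have h2 := hy.init _ hs
    rw [add_sub_cancel] at h1 h2
    rw [h1, h2]
  | succ k ih =>
    have h0k : τ 0 ≤ τ k := hτ.monotone (Nat.zero_le k)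
    have hab : τ k < τ (k + 1) := hτ k.lt_succ_self
    have hopen : ∀ u, τ 0 - r ≤ u → u < τ (k + 1) → (u : EReal) < T → y u = x u := by
      intro u hu hu1 huT
      rcases le_or_gt u (τ k) with h | h
      · exact ih hu huT h
      · exact (hy.isSegment hτ h hu1 huT).eqOn hf hr.le (hτ0.trans h0k) h (hw.mono h0k)
          (hx.isSegment hτ h hu1 (EReal.coe_lt_top _))
          (fun v hv => ih (by linarith [hv.1])
            ((EReal.coe_le_coe_iff.2 (hv.2.trans h.le)).trans_lt huT) hv.2)
          ⟨by linarith, le_rfl⟩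
    rcases hk.lt_or_eq with h | rfl
    · exact hopen t ht h htT
    · have hlt : EqOn y x (Ico (τ 0 - r) (τ (k + 1))) := fun u hu =>
        hopen u hu.1 hu.2 ((EReal.coe_le_coe_iff.2 hu.2.le).trans_lt htT)
      have h0 : τ 0 < τ (k + 1) := h0k.trans_lt hab
      have hl : Function.leftLim y (τ (k + 1)) = Function.leftLim x (τ (k + 1)) := by
        refine leftLim_congr ?_ (hx.tendsto_leftLim h0 hr.le)
        filter_upwards [Ioo_mem_nhdsLT (show τ 0 - r < τ (k + 1) by linarith)] with u hu
        exact (hlt ⟨hu.1.le, hu.2⟩).symm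
      have hh : historyLeft r y (τ (k + 1)) = historyLeft r x (τ (k + 1)) := by
        rw [historyLeft, historyLeft, hl]
        refine history_congr fun u hu => ?_
        rcases hu.2.eq_or_lt with rfl | hu'
        · simp
        · rw [Function.update_of_ne hu'.ne, Function.update_of_ne hu'.ne]
          exact hlt ⟨by linarith [hu.1], hu'⟩
      have h1 := hy.jump (k + 1) k.succ_pos htT
      have h2 := hx.jump (k + 1) k.succ_pos (EReal.coe_lt_top _)
      rw [hl, hh] at h1
      exact sub_left_injective (h1.trans h2.symm)

end Concatenation

/-! ### Scalar inequalities for the induction over impulses. -/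

section Scalar

/-- The strict inequality is the case `c = 0`; by continuity it survives for small `c > 0`. -/
theorem exists_rate_of_lt_exp {q μ δ r : ℝ} (h : q < Real.exp (-(μ * δ))) :
    ∃ c, 0 < c ∧ q * Real.exp (c * r) ≤ Real.exp (-((μ + c) * δ)) := by
  have h1 : Continuous fun c => q * Real.exp (c * r) := by fun_prop
  have h2 : Continuous fun c => Real.exp (-((μ + c) * δ)) := by fun_prop
  have := (h1.tendsto 0).eventually_lt (h2.tendsto 0) (by simpa using h)
  obtain ⟨c, hc, hc0⟩ := ((this.filter_mono (nhdsWithin_le_nhds (s := Ioi 0))).and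
    self_mem_nhdsWithin).exists
  exact ⟨c, hc0, hc.le⟩

/-- Growth between impulses of the bound `e^Γ (A e^{-c (t - t₀)} + e^{μδ} Γ)`. -/
theorem growth_bound {μ c δ A Γ J t₀ a t v u : ℝ} (hμ : 0 ≤ μ) (hc : 0 ≤ c) (hA : 0 ≤ A)
    (hΓ : 0 ≤ Γ) (hJ : 0 ≤ J) (hat : t - a ≤ δ)
    (hv : v ≤ Real.exp Γ * (A * Real.exp (-((μ + c) * δ) - c * (a - t₀)) + Γ))
    (hu : u ≤ Real.exp (J + μ * (t - a)) * (v + J)) :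
    u ≤ Real.exp (Γ + J) * (A * Real.exp (-(c * (t - t₀))) + Real.exp (μ * δ) * (Γ + J)) := by
  set X := Real.exp (-((μ + c) * δ) - c * (a - t₀)) with hX
  have hX0 : 0 < X := Real.exp_pos _
  have h1 : v + J ≤ Real.exp Γ * (A * X + (Γ + J)) := by
    have := mul_le_mul_of_nonneg_right (Real.one_le_exp hΓ) hJ
    linarith
  have h2 : Real.exp (J + μ * (t - a)) ≤ Real.exp J * Real.exp (μ * δ) := by
    rw [← Real.exp_add]
    exact Real.exp_le_exp.2 (add_le_add_right (mul_le_mul_of_nonneg_left hat hμ) J)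
  -- The reserve `e^{-(μ+c)δ}` gained at the last impulse pays for growth at rate `μ` and for decay
  -- at rate `c` over a time of at most `δ`.
  have h3 : Real.exp (μ * δ) * X ≤ Real.exp (-(c * (t - t₀))) := by
    rw [hX, ← Real.exp_add]
    have := mul_le_mul_of_nonneg_left hat hc
    exact Real.exp_le_exp.2 (by linarith)
  calc u ≤ Real.exp (J + μ * (t - a)) * (v + J) := hu
    _ ≤ Real.exp (J + μ * (t - a)) * (Real.exp Γ * (A * X + (Γ + J))) := by gcongr
    _ ≤ Real.exp J * Real.exp (μ * δ) * (Real.exp Γ * (A * X + (Γ + J))) := by gcongr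
    _ = Real.exp (Γ + J) * (A * (Real.exp (μ * δ) * X) + Real.exp (μ * δ) * (Γ + J)) := by
      rw [Real.exp_add]; ring
    _ ≤ _ := by gcongr

/-- Contraction at an impulse of the bound `e^Γ (A e^{-c (t - t₀)} + e^{μδ} Γ)`. -/
theorem jump_bound {q μ c δ r A Γ χ t₀ b v : ℝ} (hA : 0 ≤ A) (hΓ : 0 ≤ Γ) (hχ : 0 ≤ χ)
    (hq : q * Real.exp (μ * δ) ≤ 1) (hqc : q * Real.exp (c * r) ≤ Real.exp (-((μ + c) * δ)))
    (hv : v ≤ q * (Real.exp Γ * (A * Real.exp (-(c * (b - r - t₀))) + Real.exp (μ * δ) * Γ)) + χ) :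
    v ≤ Real.exp (Γ + χ) *
      (A * Real.exp (-((μ + c) * δ) - c * (b - t₀)) + (Γ + χ)) := by
  have e1 : Real.exp (-(c * (b - r - t₀))) = Real.exp (c * r) * Real.exp (-(c * (b - t₀))) := by
    rw [← Real.exp_add]; ring_nf
  have e2 : Real.exp (-((μ + c) * δ) - c * (b - t₀)) =
      Real.exp (-((μ + c) * δ)) * Real.exp (-(c * (b - t₀))) := by
    rw [← Real.exp_add]; ring_nf
  set Y := Real.exp (-(c * (b - t₀))) with hY
  have hY0 : 0 < Y := Real.exp_pos _
  set Z := Real.exp (-((μ + c) * δ))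
  have hZ0 : 0 < Z := Real.exp_pos _
  calc v ≤ _ := hv
    _ = Real.exp Γ * (A * ((q * Real.exp (c * r)) * Y) + (q * Real.exp (μ * δ)) * Γ) + χ := by
      rw [e1]; ring
    -- The two smallness conditions act separately: `hqc` restores the reserve in the decaying term,
    -- and `hq` removes the factor `e^{μδ}` from the input term.
    _ ≤ Real.exp Γ * (A * (Z * Y) + 1 * Γ) + χ := by gcongr
    _ ≤ Real.exp Γ * (A * (Z * Y) + (Γ + χ)) := by
      have := mul_le_mul_of_nonneg_right (Real.one_le_exp hΓ) hχ
      linarith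
    _ ≤ _ := by
      rw [e2]
      gcongr
      linarith

/-- `1 + v ≤ e^Γ (1 + Y + c Γ) ≤ e^{Γ + Y + c Γ}`: the logarithm makes the multiplicative effect of
the input additive. -/
theorem log_one_add_le {v Γ Y c : ℝ} (hv : 0 ≤ v) (hΓ : 0 ≤ Γ)
    (h : v ≤ Real.exp Γ * (Y + c * Γ)) : Real.log (1 + v) ≤ Y + (1 + c) * Γ := by
  rw [Real.log_le_iff_le_exp (by linarith), show Y + (1 + c) * Γ = Γ + (Y + c * Γ) by ring,
    Real.exp_add]
  have h1 := mul_le_mul_of_nonneg_left (Real.add_one_le_exp (Y + c * Γ)) (Real.exp_pos Γ).le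
  have h2 := Real.one_le_exp hΓ
  linarith

end Scalar

/-! ### The Lyapunov estimate along impulsive solutions. -/

section Estimate

set_option linter.unusedSectionVars false

variable {E F : Type*} [NormedAddCommGroup E] [NormedSpace ℝ E] [NormedAddCommGroup F]
variable {r : ℝ} {f : ℝ → PCHist E r → F → E} {I : ℕ → ℝ → PCHist E r → F → E}
  {τ : ℕ → ℝ} {φ : PCHist E r} {w : ℝ → F} {V₁ : ℝ → E → ℝ} {V₂ : ℝ → PCHist E r → ℝ}
  {χ : ℝ → ℝ} {μ κ ρ₁ ρ₂ δ : ℝ} {x : ℝ → E}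

/-- Both trajectories make `V₂` continuous up to `b` and agree before `b`, so the two values at `b`
are limits of the same function. This is why `V₂` does not jump at impulses. -/
theorem ClassNuStar.history_update_eq (h : ClassNuStar r V₂) (hr : 0 ≤ r) {a b : ℝ} (ha : 0 ≤ a)
    (hab : a < b) (hx : IsPCOn x (a - r) b) (z : E) :
    V₂ b (history r (Function.update x b z) b) = V₂ b (history r x b) := by
  have hlt : ∀ t < b, Function.update x b z t = x t := fun t ht => Function.update_of_ne ht.ne _ _
  have hle : 𝓝[<] b ≤ 𝓝[Icc a b] b := by
    rw [← nhdsWithin_Ioo_eq_nhdsLT hab]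
    exact nhdsWithin_mono _ Ioo_subset_Icc_self
  have h1 := (h.continuousOn hr ha hab.le hx b ⟨hab.le, le_rfl⟩).mono_left hle
  have h2 := (h.continuousOn hr ha hab.le (hx.congr_Ico (g' := Function.update x b z)
    fun t ht => hlt t ht.2) b ⟨hab.le, le_rfl⟩).mono_left hle
  refine tendsto_nhds_unique h2 (h1.congr' ?_)
  filter_upwards [self_mem_nhdsWithin] with t ht
  rw [history_congr (x := x) fun u hu => (hlt u (hu.2.trans_lt ht)).symm]

/-- After the jump, `V ≤ ρ₁ V₁ + ρ₂ sup V₁ + χ + V₂`, with `V₁` taken at the left limit. Splitting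
`V₂ = ρ₁ V₂ + (1 - ρ₁) V₂` bounds the first part together with `ρ₁ V₁` by `ρ₁ S`, and (iv) is spent
only on the second. -/
theorem IsSolution.jump_le (hx : IsSolution r f I τ φ w ⊤ x) (h : IsFlowLyapunov r f V₁ V₂ χ μ)
    (hr : 0 < r) (hτ0 : 0 ≤ τ 0) (hτ : StrictMono τ) (hρ₁ : 0 ≤ ρ₁) (hρ₁' : ρ₁ ≤ 1) (hρ₂ : 0 ≤ ρ₂)
    (hκ : 0 ≤ κ)
    (h3 : ∀ k, 1 ≤ k → ∀ t, 0 ≤ t → ∀ (φ : PCHist E r) (y : F), V₁ t (φ 0 + I k t φ y) ≤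
      ρ₁ * V₁ t (φ 0) + ρ₂ * (⨆ s : Set.Icc (-r) (0 : ℝ), V₁ (t + s) (φ s)) + χ ‖y‖)
    (h4 : ∀ t, 0 ≤ t → ∀ φ : PCHist E r,
      V₂ t φ ≤ κ * ⨆ s : Set.Icc (-r) (0 : ℝ), V₁ (t + s) (φ s))
    {k : ℕ} {S : ℝ} (hS : ∀ s ∈ Ico (τ (k + 1) - r) (τ (k + 1)), V₁ s (x s) ≤ S)
    (hS' : V₁ (τ (k + 1)) (Function.leftLim x (τ (k + 1))) +
      V₂ (τ (k + 1)) (historyLeft r x (τ (k + 1))) ≤ S) :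
    V₁ (τ (k + 1)) (x (τ (k + 1))) + V₂ (τ (k + 1)) (history r x (τ (k + 1))) ≤
      (ρ₁ + ρ₂ + (1 - ρ₁) * κ) * S + χ ‖Function.leftLim w (τ (k + 1))‖ := by
  have h0k : τ 0 ≤ τ k := hτ.monotone (Nat.zero_le k)
  have hab : τ k < τ (k + 1) := hτ k.lt_succ_self
  have hj := hx.jump (k + 1) k.succ_pos (EReal.coe_lt_top _)
  set b := τ (k + 1) with hb
  have hb0 : 0 ≤ b := by linarith
  have hpc : IsPCOn x (τ k - r) b :=
    (hx.isPC b (by linarith) (EReal.coe_lt_top _)).mono (by linarith) le_rfl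
  have hpcu : IsPCOn (Function.update x b (Function.leftLim x b)) (b - r) b :=
    (hpc.mono (by linarith) le_rfl).congr_Ico fun t ht => Function.update_of_ne ht.2.ne _ _
  have hV₂ : V₂ b (historyLeft r x b) = V₂ b (history r x b) :=
    h.nuStar.history_update_eq hr.le (hτ0.trans h0k) hab hpc _
  have hφ0 : historyLeft r x b 0 = Function.leftLim x b := by
    rw [historyLeft, history_apply hpcu ⟨by linarith, le_rfl⟩, add_zero, Function.update_self]
  have hn₁ := h.nonneg₁ b hb0 (Function.leftLim x b)
  have hn₂ := h.nonneg₂ b hb0 (historyLeft r x b)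
  have hsup : (⨆ s : Set.Icc (-r) (0 : ℝ), V₁ (b + s) (historyLeft r x b s)) ≤ S := by
    refine Real.iSup_le (fun s => ?_) (by linarith)
    rw [historyLeft, history_apply hpcu s.2]
    rcases s.2.2.eq_or_lt with h0 | h0
    · rw [h0, add_zero, Function.update_self]
      linarith
    · rw [Function.update_of_ne (by linarith)]
      exact hS _ ⟨by linarith [s.2.1], by linarith⟩
  have h3' := h3 (k + 1) k.succ_pos b hb0 (historyLeft r x b) (Function.leftLim w b)
  rw [← hj, hφ0, add_sub_cancel] at h3'
  have h4' := (h4 b hb0 (historyLeft r x b)).trans (mul_le_mul_of_nonneg_left hsup hκ)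
  have h5 := mul_le_mul_of_nonneg_left hsup hρ₂
  have h6 := mul_le_mul_of_nonneg_left h4' (sub_nonneg.2 hρ₁')
  have h7 := mul_le_mul_of_nonneg_left hS' hρ₁
  rw [← hV₂]
  linarith

theorem IsSolution.history_zero (hx : IsSolution r f I τ φ w ⊤ x) :
    history r x (τ 0) = φ := by
  have : IsPCOn x (τ 0 - r) (τ 0) :=
    (hx.isPC (τ 0 + 1) (by linarith) (EReal.coe_lt_top _)).mono le_rfl (by linarith)
  refine PCHist.ext_Icc fun s hs => ?_
  rw [history_apply this hs, hx.init s hs]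

/-- The exponential bound on `V₁ + V₂` along a solution of the impulsive system. -/
theorem IsSolution.lyapunov_le (hx : IsSolution r f I τ φ w ⊤ x)
    (h : IsFlowLyapunov r f V₁ V₂ χ μ) (hχ : ClassK χ) (hμ : 0 ≤ μ)
    (hr : 0 < r) (hτ0 : 0 ≤ τ 0) (hτ : StrictMono τ) (hτδ : ∀ k, τ (k + 1) - τ k ≤ δ)
    (hw : IsPCFrom w (τ 0))
    (hρ₁ : 0 ≤ ρ₁) (hρ₁' : ρ₁ ≤ 1) (hρ₂ : 0 ≤ ρ₂) (hκ : 0 ≤ κ)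
    (h3 : ∀ k, 1 ≤ k → ∀ t, 0 ≤ t → ∀ (φ : PCHist E r) (y : F), V₁ t (φ 0 + I k t φ y) ≤
      ρ₁ * V₁ t (φ 0) + ρ₂ * (⨆ s : Set.Icc (-r) (0 : ℝ), V₁ (t + s) (φ s)) + χ ‖y‖)
    (h4 : ∀ t, 0 ≤ t → ∀ φ : PCHist E r,
      V₂ t φ ≤ κ * ⨆ s : Set.Icc (-r) (0 : ℝ), V₁ (t + s) (φ s))
    {c A : ℝ} (hc : 0 ≤ c)
    (hq : (ρ₁ + ρ₂ + (1 - ρ₁) * κ) * Real.exp (μ * δ) ≤ 1)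
    (hqc : (ρ₁ + ρ₂ + (1 - ρ₁) * κ) * Real.exp (c * r) ≤ Real.exp (-((μ + c) * δ)))
    (hA : ∀ s ∈ Icc (-r) 0, V₁ (τ 0 + s) (φ s) ≤ A)
    (hA' : V₁ (τ 0) (φ 0) + V₂ (τ 0) φ ≤ A * Real.exp (-((μ + c) * δ)))
    (k : ℕ) {t : ℝ} (ht : t ∈ Ico (τ k) (τ (k + 1))) :
    V₁ t (x t) + V₂ t (history r x t) ≤
      Real.exp ((∫ s in τ 0..t, χ ‖w s‖) + ∑ j ∈ Finset.Icc 1 k, χ ‖Function.leftLim w (τ j)‖) *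
        (A * Real.exp (-(c * (t - τ 0))) + Real.exp (μ * δ) *
          ((∫ s in τ 0..t, χ ‖w s‖) + ∑ j ∈ Finset.Icc 1 k, χ ‖Function.leftLim w (τ j)‖)) := by
  set V : ℝ → ℝ := fun t => V₁ t (x t) + V₂ t (history r x t) with hV
  set H : ℝ → ℝ := fun t => ∫ s in τ 0..t, χ ‖w s‖ with hH
  set Sw : ℕ → ℝ := fun k => ∑ j ∈ Finset.Icc 1 k, χ ‖Function.leftLim w (τ j)‖ with hSw
  set bd : ℝ → ℝ → ℝ := fun t Γ =>
    Real.exp Γ * (A * Real.exp (-(c * (t - τ 0))) + Real.exp (μ * δ) * Γ) with hbd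
  change V t ≤ bd t (H t + Sw k)
  have hp0 : ∀ s, 0 ≤ χ ‖w s‖ := fun s => hχ.nonneg (norm_nonneg _)
  have hpi : ∀ a b, τ 0 ≤ a → a ≤ b → IntervalIntegrable (fun s => χ ‖w s‖) volume a b :=
    fun a b ha hab => (((hw.isPCOn b).mono ha le_rfl).comp
      hχ.continuous_comp_norm).intervalIntegrable hab
  have hHadd : ∀ a b, τ 0 ≤ a → a ≤ b → H b = H a + ∫ s in a..b, χ ‖w s‖ := fun a b ha hab =>
    (intervalIntegral.integral_add_adjacent_intervals (hpi _ _ le_rfl ha) (hpi _ _ ha hab)).symm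
  have hJ0 : ∀ a b, a ≤ b → 0 ≤ ∫ s in a..b, χ ‖w s‖ := fun a b hab =>
    intervalIntegral.integral_nonneg hab fun s _ => hp0 s
  have hSw0 : ∀ k, 0 ≤ Sw k := fun k => Finset.sum_nonneg fun j _ => hχ.nonneg (norm_nonneg _)
  have hSws : ∀ k, Sw (k + 1) = Sw k + χ ‖Function.leftLim w (τ (k + 1))‖ := fun k =>
    Finset.sum_Icc_succ_top (by omega) _
  have h0 : ∀ k, τ 0 ≤ τ k := fun k => hτ.monotone (Nat.zero_le k)
  have hφ0 : 0 ≤ V₁ (τ 0) (φ 0) := h.nonneg₁ _ hτ0 _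
  have hA0 : 0 ≤ A := hφ0.trans (by simpa using hA 0 ⟨by linarith, le_rfl⟩)
  have hbd_mono : ∀ t Γ Γ', 0 ≤ Γ → Γ ≤ Γ' → bd t Γ ≤ bd t Γ' := fun t Γ Γ' h1 h2 => by
    simp only [hbd]
    gcongr
  -- The closed interval is covered by the updated trajectory, so at the right end this bounds the
  -- left limit of `V`.
  have hinterval : ∀ k, V (τ k) ≤ Real.exp (H (τ k) + Sw k) *
      (A * Real.exp (-((μ + c) * δ) - c * (τ k - τ 0)) + (H (τ k) + Sw k)) →
      ∀ t ∈ Icc (τ k) (τ (k + 1)),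
        V₁ t (Function.update x (τ (k + 1)) (Function.leftLim x (τ (k + 1))) t) +
        V₂ t (history r (Function.update x (τ (k + 1)) (Function.leftLim x (τ (k + 1)))) t) ≤
          bd t (H t + Sw k) := by
    intro k hk t ht
    have hab : τ k < τ (k + 1) := hτ k.lt_succ_self
    have hseg := hx.isSegment_update hr.le hτ k
    have h1 := h.le_exp_mul hχ hμ hr.le (hτ0.trans (h0 k)) hab.le (hw.mono (h0 k)) hseg t ht
    rw [Function.update_of_ne hab.ne, history_congr (y := x) fun u hu =>
      Function.update_of_ne (hu.2.trans_lt hab).ne _ _] at h1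
    have h2 := growth_bound hμ hc hA0 (add_nonneg (hJ0 _ _ (h0 k)) (hSw0 k)) (hJ0 _ _ ht.1)
      (by linarith [ht.2, hτδ k]) hk h1
    rw [add_right_comm, ← hHadd _ _ (h0 k) ht.1] at h2
    exact h2
  have hupd : ∀ k, ∀ t < τ (k + 1),
      V₁ t (Function.update x (τ (k + 1)) (Function.leftLim x (τ (k + 1))) t) +
      V₂ t (history r (Function.update x (τ (k + 1)) (Function.leftLim x (τ (k + 1)))) t) =
      V t := fun k t ht => by
    rw [Function.update_of_ne ht.ne, history_congr (y := x) fun u hu =>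
      Function.update_of_ne (hu.2.trans_lt ht).ne _ _]
  -- The induction carries the stronger bound just after each impulse and the weaker one on all
  -- earlier times, with the input frozen at its value at `τ k`; the delay may reach back over
  -- several impulses.
  have hmain : ∀ k, V (τ k) ≤ Real.exp (H (τ k) + Sw k) *
      (A * Real.exp (-((μ + c) * δ) - c * (τ k - τ 0)) + (H (τ k) + Sw k)) ∧
      ∀ t ∈ Ico (τ 0) (τ k), V t ≤ bd t (H (τ k) + Sw k) := by
    intro k
    induction k with
    | zero =>
      refine ⟨?_, fun t ht => absurd (ht.1.trans_lt ht.2) (lt_irrefl _)⟩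
      have hx0 : x (τ 0) = φ 0 := by simpa using hx.init 0 ⟨by linarith, le_rfl⟩
      simp only [hV, hx0, hx.history_zero, hH, hSw]
      simpa using hA'
    | succ k ih =>
      have hab : τ k < τ (k + 1) := hτ k.lt_succ_self
      have hint := hinterval k ih.1
      set b := τ (k + 1) with hb
      have hHb : ∀ t, τ 0 ≤ t → t ≤ b → 0 ≤ H t ∧ H t ≤ H b := fun t h1 h2 =>
        ⟨hJ0 _ _ h1, by rw [hHadd t b h1 h2]; linarith [hJ0 _ _ h2]⟩
      have hbefore : ∀ t ∈ Ico (τ 0) b, V t ≤ bd t (H b + Sw k) := by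
        intro t ht
        rcases lt_or_ge t (τ k) with h' | h'
        · refine (ih.2 t ⟨ht.1, h'⟩).trans (hbd_mono _ _ _ ?_ ?_)
          · exact add_nonneg (hJ0 _ _ (h0 k)) (hSw0 k)
          · linarith [(hHb (τ k) (h0 k) hab.le).2]
        · have h1 := hint t ⟨h', ht.2.le⟩
          rw [hupd k t ht.2] at h1
          have h2 := hHb t ht.1 ht.2.le
          exact h1.trans (hbd_mono _ _ _ (add_nonneg h2.1 (hSw0 k)) (by linarith [h2.2]))
      have hHb0 : 0 ≤ H b := hJ0 _ _ (h0 (k + 1))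
      have hΓ : 0 ≤ H b + Sw k := add_nonneg hHb0 (hSw0 k)
      have hχ0 : 0 ≤ χ ‖Function.leftLim w b‖ := hχ.nonneg (norm_nonneg _)
      have hbd_anti : ∀ t, b - r ≤ t → bd t (H b + Sw k) ≤ bd (b - r) (H b + Sw k) := fun t ht => by
        simp only [hbd]
        gcongr
      -- The bound decreases in time for fixed input, so its value at `b - r` dominates the whole
      -- delay window.
      have hjump := hx.jump_le h hr hτ0 hτ hρ₁ hρ₁' hρ₂ hκ h3 h4 (k := k)
        (S := bd (b - r) (H b + Sw k)) (fun s hs => ?_) ?_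
      · have h1 := jump_bound hA0 hΓ hχ0 hq hqc hjump
        rw [add_assoc, ← hSws] at h1
        refine ⟨h1, fun t ht => (hbefore t ht).trans (hbd_mono _ _ _ hΓ ?_)⟩
        rw [hSws]
        linarith
      · rcases lt_or_ge s (τ 0) with h' | h'
        · have hm : s - τ 0 ∈ Icc (-r) 0 := ⟨by linarith [hs.1, h0 (k + 1)], by linarith⟩
          have h1 := hA _ hm
          rw [← hx.init _ hm, add_sub_cancel] at h1
          refine h1.trans ?_
          -- Here the window reaches into the initial function: `b - r ≤ s < τ 0` makes the exponent
          -- nonnegative, so the bound is at least `A`.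
          have h2 : 1 ≤ Real.exp (-(c * (b - r - τ 0))) :=
            Real.one_le_exp (by nlinarith [hs.1, mul_nonneg hc (sub_nonneg.2 (hs.1.trans h'.le))])
          have h3 := Real.one_le_exp hΓ
          have h4 : A ≤ A * Real.exp (-(c * (b - r - τ 0))) := le_mul_of_one_le_right hA0 h2
          have h5 : 0 ≤ Real.exp (μ * δ) * (H b + Sw k) := by positivity
          calc A ≤ 1 * (A * Real.exp (-(c * (b - r - τ 0))) + Real.exp (μ * δ) * (H b + Sw k)) := by
                linarith
            _ ≤ _ := by
                simp only [hbd]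
                gcongr
        · refine le_trans ?_ ((hbefore s ⟨h', hs.2⟩).trans (hbd_anti s hs.1))
          exact le_add_of_nonneg_right (h.nonneg₂ s (hτ0.trans h') _)
      · have h1 := hint b ⟨hab.le, le_rfl⟩
        rw [Function.update_self] at h1
        exact h1.trans (hbd_anti b (by linarith))
  have h1 := hinterval k (hmain k).1 t (Ico_subset_Icc_self ht)
  rwa [hupd k t ht.2] at h1

end Estimate

/-! ### Closure properties of comparison functions. -/

section ComparisonFunctions

theorem ClassKInf.log_one_add {α : ℝ → ℝ} (h : ClassKInf α) :
    ClassKInf fun s => Real.log (1 + α s) where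
  continuousOn := (continuousOn_const.add h.continuousOn).log fun s hs => by
    have := h.toClassK.nonneg hs
    exact (by linarith : 0 < 1 + α s).ne'
  strictMonoOn s hs t ht hst := by
    have := h.toClassK.nonneg hs
    exact Real.log_lt_log (by positivity) (by linarith [h.strictMonoOn hs ht hst])
  map_zero := by simp [h.map_zero]
  tendsto_atTop := Real.tendsto_log_atTop.comp
    (tendsto_atTop_add_const_left _ _ h.tendsto_atTop)

theorem ClassKInf.const_mul {α : ℝ → ℝ} (h : ClassKInf α) {c : ℝ} (hc : 0 < c) :
    ClassKInf fun s => c * α s where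
  continuousOn := continuousOn_const.mul h.continuousOn
  strictMonoOn s hs t ht hst := mul_lt_mul_of_pos_left (h.strictMonoOn hs ht hst) hc
  map_zero := by simp [h.map_zero]
  tendsto_atTop := h.tendsto_atTop.const_mul_atTop hc

theorem ClassK.add {α α' : ℝ → ℝ} (h : ClassK α) (h' : ClassK α') :
    ClassK fun s => α s + α' s where
  continuousOn := h.continuousOn.add h'.continuousOn
  strictMonoOn s hs t ht hst := add_lt_add (h.strictMonoOn hs ht hst) (h'.strictMonoOn hs ht hst)
  map_zero := by simp [h.map_zero, h'.map_zero]

theorem ClassK.mul_exp_neg {α : ℝ → ℝ} (h : ClassK α) {C c : ℝ} (hC : 0 < C) (hc : 0 < c) :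
    ClassKL fun s t => C * α s * Real.exp (-(c * t)) where
  continuousOn := by
    refine ContinuousOn.mul (continuousOn_const.mul ?_) (by fun_prop)
    exact h.continuousOn.comp continuousOn_fst fun p hp => hp.1
  classK t _ :=
    { continuousOn := (continuousOn_const.mul h.continuousOn).mul continuousOn_const
      strictMonoOn := fun s hs t ht hst => mul_lt_mul_of_pos_right
        (mul_lt_mul_of_pos_left (h.strictMonoOn hs ht hst) hC) (Real.exp_pos _)
      map_zero := by simp [h.map_zero] }
  antitoneOn s hs t _ t' _ htt' := by
    have := h.nonneg hs
    simp only
    gcongr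
  tendsto_zero s _ := by
    have h1 : Tendsto (fun t => Real.exp (-(c * t))) atTop (𝓝 0) :=
      Real.tendsto_exp_neg_atTop_nhds_zero.comp (tendsto_id.const_mul_atTop hc)
    simpa using h1.const_mul (C * α s)

end ComparisonFunctions

/-! ### Indexing of impulses, and the main theorem. -/

theorem finsum_mem_impulses_eq {τ : ℕ → ℝ} (hτ : StrictMono τ) {k : ℕ} {t : ℝ}
    (ht : t ∈ Ico (τ k) (τ (k + 1))) (g : ℕ → ℝ) :
    ∑ᶠ j ∈ {j : ℕ | τ 0 < τ j ∧ τ j ≤ t}, g j = ∑ j ∈ Finset.Icc 1 k, g j := by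
  have : {j : ℕ | τ 0 < τ j ∧ τ j ≤ t} = ↑(Finset.Icc 1 k) := by
    ext j
    simp only [mem_ofPred_eq, Finset.coe_Icc, mem_Icc, hτ.lt_iff_lt]
    refine and_congr Iff.rfl ⟨fun h => ?_, fun h => (hτ.monotone h).trans ht.1⟩
    exact Nat.lt_succ_iff.1 (hτ.lt_iff_lt.1 (h.trans_lt ht.2))
  rw [this, finsum_mem_coe_finset]

theorem exists_mem_Ico_impulses {τ : ℕ → ℝ} (hτ' : Tendsto τ atTop atTop) {t : ℝ}
    (ht : τ 0 ≤ t) : ∃ k, t ∈ Ico (τ k) (τ (k + 1)) := by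
  have hex : ∃ k, t < τ k := (hτ'.eventually_gt_atTop t).exists
  classical
  obtain ⟨k, hk⟩ : ∃ k, Nat.find hex = k + 1 := Nat.exists_eq_succ_of_ne_zero fun h0 => by
    have := Nat.find_spec hex
    rw [h0] at this
    exact ht.not_gt this
  exact ⟨k, not_lt.1 (Nat.find_min hex (by omega)), hk ▸ Nat.find_spec hex⟩

theorem theorem2 (n m : ℕ) (r : ℝ) (hr : 0 < r)
    (f : ℝ → PCHist (EuclideanSpace ℝ (Fin n)) r → EuclideanSpace ℝ (Fin m) →
      EuclideanSpace ℝ (Fin n))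
    (I : ℕ → ℝ → PCHist (EuclideanSpace ℝ (Fin n)) r → EuclideanSpace ℝ (Fin m) →
      EuclideanSpace ℝ (Fin n))
    -- standing assumptions on the system
    (hf_zero : ∀ t, 0 ≤ t → f t 0 0 = 0)
    (hI_zero : ∀ k, 1 ≤ k → ∀ t, 0 ≤ t → I k t 0 0 = 0)
    (hf_reg : RegularRHS r f)
    -- Lyapunov data
    (V₁ : ℝ → EuclideanSpace ℝ (Fin n) → ℝ) (hV₁ : ClassNu V₁)
    (V₂ : ℝ → PCHist (EuclideanSpace ℝ (Fin n)) r → ℝ) (hV₂ : ClassNuStar r V₂)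
    (α₁ α₂ α₃ χ : ℝ → ℝ) (hα₁ : ClassKInf α₁) (hα₂ : ClassKInf α₂) (hα₃ : ClassKInf α₃)
    (hχ : ClassKInf χ)
    (μ κ ρ₁ ρ₂ δ : ℝ) (hμ : 0 < μ) (hκ : 0 < κ) (hρ₁ : 0 ≤ ρ₁) (hρ₁' : ρ₁ < 1) (hρ₂ : 0 ≤ ρ₂)
    (hδ : 0 < δ)
    -- (i)
    (h1 : ∀ t, -r ≤ t → ∀ x, α₁ ‖x‖ ≤ V₁ t x ∧ V₁ t x ≤ α₂ ‖x‖)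
    (h1' : ∀ t, 0 ≤ t → ∀ φ, 0 ≤ V₂ t φ ∧ V₂ t φ ≤ α₃ (supNorm r φ))
    -- (ii)
    (h2 : ∀ t, 0 ≤ t → ∀ (φ : PCHist (EuclideanSpace ℝ (Fin n)) r)
      (w : ℝ → EuclideanSpace ℝ (Fin m)), IsPCFrom w t →
      ∀ (T : ℝ) (x : ℝ → EuclideanSpace ℝ (Fin n)), t < T → IsFlow r f w t φ T x →
        upperDini r (fun s ψ => V₁ s (ψ 0) + V₂ s ψ) x t ≤
          (((χ ‖w t‖ + μ) * (V₁ t (φ 0) + V₂ t φ) + χ ‖w t‖ : ℝ) : EReal))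
    -- (iii)
    (h3 : ∀ k, 1 ≤ k → ∀ t, 0 ≤ t → ∀ (φ : PCHist (EuclideanSpace ℝ (Fin n)) r)
      (y : EuclideanSpace ℝ (Fin m)),
        V₁ t (φ 0 + I k t φ y) ≤
          ρ₁ * V₁ t (φ 0) + ρ₂ * (⨆ s : Set.Icc (-r) (0 : ℝ), V₁ (t + s) (φ s)) + χ ‖y‖)
    -- (iv)
    (h4 : ∀ t, 0 ≤ t → ∀ φ : PCHist (EuclideanSpace ℝ (Fin n)) r,
      V₂ t φ ≤ κ * ⨆ s : Set.Icc (-r) (0 : ℝ), V₁ (t + s) (φ s))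
    -- (v)
    (h5 : Real.log (ρ₁ + ρ₂ + (1 - ρ₁) * κ) < -μ * δ) :
    UniformlyIISS r f I (ellSup δ) := by
  have hV : IsFlowLyapunov r f V₁ V₂ χ μ := ⟨hV₁, hV₂, fun t ht x =>
    (hα₁.toClassK.nonneg (norm_nonneg x)).trans (h1 t (by linarith) x).1,
    fun t ht φ => (h1' t ht φ).1, h2⟩
  set q := ρ₁ + ρ₂ + (1 - ρ₁) * κ with hq
  have hq0 : 0 < q := by
    have := mul_pos (sub_pos.2 hρ₁') hκ
    positivity
  have hqlt : q < Real.exp (-(μ * δ)) := by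
    rw [← neg_mul]
    exact (Real.log_lt_iff_lt_exp hq0).1 h5
  obtain ⟨c, hc, hqc⟩ := exists_rate_of_lt_exp (r := r) hqlt
  have hq1 : q * Real.exp (μ * δ) ≤ 1 := by
    have := mul_le_mul_of_nonneg_right hqlt.le (Real.exp_pos (μ * δ)).le
    rwa [← Real.exp_add, neg_add_cancel, Real.exp_zero] at this
  -- At the initial time the induction needs the reserve `e^{-(μ+c)δ}` as if an impulse had just
  -- occurred; the factor `C` in the amplitude supplies it.
  set C := Real.exp ((μ + c) * δ) with hC
  set d := Real.exp (μ * δ) with hd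
  have hC1 : 1 ≤ C := Real.one_le_exp (by positivity)
  have hd0 : 0 < d := Real.exp_pos _
  -- The factor `1 + d` collects one `Γ` from the logarithm of `e^Γ` and `d Γ` from the additive
  -- input term.
  refine ⟨fun s t => C * (α₂ s + α₃ s) * Real.exp (-(c * t)), fun s => Real.log (1 + α₁ s),
    fun s => (1 + d) * χ s, (hα₂.toClassK.add hα₃.toClassK).mul_exp_neg (by positivity) hc,
    hα₁.log_one_add, hχ.const_mul (by positivity), ?_⟩
  rintro τ ⟨hτ0, hτ, hτ', hτδ⟩ φ w hw
  have h0 : ∀ k, τ 0 ≤ τ k := fun k => hτ.monotone (Nat.zero_le k)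
  obtain ⟨x, hx⟩ : ∃ x, IsSolution r f I τ φ w ⊤ x :=
    exists_isSolution hr hτ hτ' fun k ψ hψ => hV.exists_segment hχ.toClassK hμ.le hf_reg hα₁
      (fun t ht x => (h1 t (by linarith) x).1) hr.le (hτ0.trans (h0 k)) (hτ k.lt_succ_self)
      (hw.mono (h0 k)) hψ
  refine ⟨x, hx, fun T y hy t ht htT => hx.eq_of_lt hf_reg hr hτ0 hτ hτ' hw hy ht htT,
    fun t ht => ?_⟩
  obtain ⟨k, hk⟩ := exists_mem_Ico_impulses hτ' ht
  set N := supNorm r φ with hN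
  have hN0 : 0 ≤ N := supNorm_nonneg _
  have hφ : ∀ s ∈ Icc (-r) 0, V₁ (τ 0 + s) (φ s) ≤ α₂ N := fun s hs =>
    (h1 _ (by linarith [hs.1]) _).2.trans
      (hα₂.strictMonoOn.monotoneOn (norm_nonneg _) hN0 (φ.norm_le_supNorm hs))
  have hα₂N := hα₂.toClassK.nonneg hN0
  have hα₃N := hα₃.toClassK.nonneg hN0
  have hA : ∀ s ∈ Icc (-r) 0, V₁ (τ 0 + s) (φ s) ≤ C * (α₂ N + α₃ N) := fun s hs =>
    (hφ s hs).trans (by nlinarith)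
  have hA' : V₁ (τ 0) (φ 0) + V₂ (τ 0) φ ≤
      C * (α₂ N + α₃ N) * Real.exp (-((μ + c) * δ)) := by
    rw [mul_right_comm, hC, ← Real.exp_add, add_neg_cancel, Real.exp_zero, one_mul]
    have := hφ 0 ⟨by linarith, le_rfl⟩
    rw [add_zero] at this
    exact add_le_add this (h1' _ hτ0 φ).2
  have hbound := hx.lyapunov_le hV hχ.toClassK hμ.le hr hτ0 hτ hτδ hw hρ₁ hρ₁'.le hρ₂ hκ.le h3 h4
    hc.le hq1 hqc hA hA' k hk
  have hα := (h1 t (by linarith) (x t)).1.trans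
    ((le_add_of_nonneg_right (h1' t (hτ0.trans ht) (history r x t)).1).trans hbound)
  have hΓ : 0 ≤ (∫ s in τ 0..t, χ ‖w s‖) +
      ∑ j ∈ Finset.Icc 1 k, χ ‖Function.leftLim w (τ j)‖ :=
    add_nonneg (intervalIntegral.integral_nonneg ht fun s _ => hχ.toClassK.nonneg (norm_nonneg _))
      (Finset.sum_nonneg fun j _ => hχ.toClassK.nonneg (norm_nonneg _))
  have hlog := log_one_add_le (hα₁.toClassK.nonneg (norm_nonneg _)) hΓ hα
  rw [finsum_mem_impulses_eq hτ hk, intervalIntegral.integral_const_mul, ← Finset.mul_sum,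
    add_assoc, ← mul_add]
  exact hlog
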